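/- For integers $\chi\ge 1$ and $\Delta\ge 0$, a $(\chi,\Delta)$-coloring of a finite simple graph $G=(V,E)$ is a function $c:V\to\{1,\dots,\chi\}$ such that for every $i$ the subgraph of $G$ induced by $c^{-1}(i)$ has maximum degree at most $\Delta$. Defective Coloring is the problem of deciding, given $G,\chi,\Delta$, whether $G$ has a $(\chi,\Delta)$-coloring. A graph is a cograph if it is a single vertex, or the disjoint union of two cographs, or the complete join of two cographs (up to isomorphism). Theorem. Defective Coloring on cographs can be solved in time $n^{O(n^{4/5})}$, where $n$ is the number of vertices. That is, there are a single deterministic random access machine program, a function $T:\mathbb N\to\mathbb N$ and a constant $C$ such that, on every input $(G,\chi,\Delta)$ where $G$ is a cograph on $n$ vertices (given by its adjacency matrix) and $\chi\ge1$, $\Delta\ge 0$ are arbitrary integers, the program halts within $T(n)$ steps and correctly answers whether $G$ has a $(\chi,\Delta)$-coloring, and $$T(n)\le n^{C\,n^{4/5}}\qquad\text{for all } n\ge 2.$$ Here a step is one elementary operation of the machine (loading a constant, addition, truncated subtraction, indirect reading from or writing to memory, or a comparison of two registers), at unit cost; there is no multiplication. -/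

import Mathlib

namespace DefectiveColoring

/-- Cographs: single vertices, closed under disjoint union and complete join
(and under renaming the vertices). -/
inductive IsCograph : {V : Type} → SimpleGraph V → Prop
  | single (G : SimpleGraph Unit) : IsCograph G
  | disjUnion {V W : Type} {G : SimpleGraph V} {H : SimpleGraph W} :
      IsCograph G → IsCograph H → IsCograph (G.sum H)
  | join {V W : Type} {G : SimpleGraph V} {H : SimpleGraph W} :
      IsCograph G → IsCograph H → IsCograph (G.sum H ⊔ completeBipartiteGraph V W)
  | iso {V W : Type} {G : SimpleGraph V} {H : SimpleGraph W} :
      G ≃g H → IsCograph G → IsCograph H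

open Classical in
/-- `c` is a `(χ, Δ)`-coloring of `G`: every color class induces a graph of maximum degree at
most `Δ`. -/
def IsColoring {V : Type} [Fintype V] (G : SimpleGraph V) (χ Δ : ℕ) (c : V → Fin χ) : Prop :=
  ∀ i : Fin χ, (G.induce (c ⁻¹' {i})).maxDegree ≤ Δ

/-- `G` admits a `(χ, Δ)`-coloring. -/
def Colorable {V : Type} [Fintype V] (G : SimpleGraph V) (χ Δ : ℕ) : Prop :=
  ∃ c : V → Fin χ, IsColoring G χ Δ c

/-! ### Random access machines

Programs of a random access machine, in structured form. A program is a finite text, so it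
mentions finitely many registers and finitely many (unbounded) arrays of natural numbers.
The arithmetic is addition and truncated subtraction only: there is no multiplication, division,
shift or bitwise operation, so that the uniform cost measure used below is polynomially related to
the running time of Turing machines. -/

/-- RAM programs. Registers and arrays are named by numbers. -/
inductive Prog : Type
  /-- register `x` := the number `k` -/
  | const (x k : ℕ)
  /-- register `x` := register `y` + register `z` -/
  | add (x y z : ℕ)
  /-- register `x` := register `y` - register `z` (truncated at `0`) -/
  | sub (x y z : ℕ)
  /-- register `x` := the entry of array `a` at the index held in register `y` -/
  | load (x a y : ℕ)
  /-- the entry of array `a` at the index held in register `x` := register `y` -/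
  | store (a x y : ℕ)
  /-- sequential composition -/
  | seq (p q : Prog)
  /-- if register `x` < register `y` then `p` else `q` -/
  | ifLt (x y : ℕ) (p q : Prog)
  /-- while register `x` < register `y` do `p` -/
  | whileLt (x y : ℕ) (p : Prog)

/-- The state of the machine: the contents of the registers and of the arrays. -/
structure State : Type where
  reg : ℕ → ℕ
  arr : ℕ → ℕ → ℕ

/-- The state `s` after writing `v` to register `x`. -/
def State.setReg (s : State) (x v : ℕ) : State :=
  { s with reg := Function.update s.reg x v }

/-- The state `s` after writing `v` to array `a` at index `i`. -/
def State.setArr (s : State) (a i v : ℕ) : State :=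
  { s with arr := Function.update s.arr a (Function.update (s.arr a) i v) }

/-- `Runs p s t s'`: program `p`, started in state `s`, halts in state `s'` after exactly `t` steps.
Every elementary instruction and every evaluation of a test takes one step. The relation is
deterministic: `p` and `s` determine `t` and `s'`. -/
inductive Runs : Prog → State → ℕ → State → Prop
  | const (s : State) (x k : ℕ) : Runs (.const x k) s 1 (s.setReg x k)
  | add (s : State) (x y z : ℕ) : Runs (.add x y z) s 1 (s.setReg x (s.reg y + s.reg z))
  | sub (s : State) (x y z : ℕ) : Runs (.sub x y z) s 1 (s.setReg x (s.reg y - s.reg z))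
  | load (s : State) (x a y : ℕ) : Runs (.load x a y) s 1 (s.setReg x (s.arr a (s.reg y)))
  | store (s : State) (a x y : ℕ) : Runs (.store a x y) s 1 (s.setArr a (s.reg x) (s.reg y))
  | seq {p q : Prog} {s s₁ s₂ : State} {t₁ t₂ : ℕ} :
      Runs p s t₁ s₁ → Runs q s₁ t₂ s₂ → Runs (.seq p q) s (t₁ + t₂) s₂
  | ifTrue {x y : ℕ} {p q : Prog} {s s' : State} {t : ℕ} :
      s.reg x < s.reg y → Runs p s t s' → Runs (.ifLt x y p q) s (1 + t) s'
  | ifFalse {x y : ℕ} {p q : Prog} {s s' : State} {t : ℕ} :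
      ¬ s.reg x < s.reg y → Runs q s t s' → Runs (.ifLt x y p q) s (1 + t) s'
  | whileTrue {x y : ℕ} {p : Prog} {s s₁ s₂ : State} {t₁ t₂ : ℕ} :
      s.reg x < s.reg y → Runs p s t₁ s₁ → Runs (.whileLt x y p) s₁ t₂ s₂ →
        Runs (.whileLt x y p) s (1 + t₁ + t₂) s₂
  | whileFalse {x y : ℕ} {p : Prog} {s : State} :
      ¬ s.reg x < s.reg y → Runs (.whileLt x y p) s 1 s

open Classical in
/-- The initial state for the instance `(G, χ, Δ)`, where `G` has vertex set `{0, …, n - 1}`: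
registers `0`, `1`, `2` hold `n`, `χ`, `Δ`, and array `0` holds the adjacency matrix of `G`, row by
row. Everything else is `0`. -/
noncomputable def input {n : ℕ} (G : SimpleGraph (Fin n)) (χ Δ : ℕ) : State where
  reg x := if x = 0 then n else if x = 1 then χ else if x = 2 then Δ else 0
  arr a k := if a = 0 ∧ ∃ i j : Fin n, k = (i : ℕ) * n + (j : ℕ) ∧ G.Adj i j then 1 else 0

/-- `p` solves Defective Coloring on cographs in time `T`: on every instance whose graph is a
cograph, with `n` vertices, it halts within `T n` steps, with `1` in register `0` if there is a
`(χ, Δ)`-coloring and with `0` in register `0` if there is none. -/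
def SolvesOnCographs (p : Prog) (T : ℕ → ℕ) : Prop :=
  ∀ (n : ℕ) (G : SimpleGraph (Fin n)), IsCograph G → ∀ χ Δ : ℕ, 1 ≤ χ →
    ∃ (t : ℕ) (s : State), Runs p (input G χ Δ) t s ∧ t ≤ T n ∧
      (Colorable G χ Δ → s.reg 0 = 1) ∧ (¬ Colorable G χ Δ → s.reg 0 = 0)

end DefectiveColoring

namespace DefectiveColoring

/-! ### Reasoning about random access machine programs -/

/-! If `n ≤ χ * (Δ + 1)`, splitting the vertices into blocks of at most `Δ + 1` gives a coloring, so
assume `χ * (Δ + 1) < n`. Every set of at least two vertices of a cograph contains twins: two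
vertices that no third vertex of the set distinguishes (`IsCograph.exists_twins`). Starting from
singletons and repeatedly merging the modules of two twin representatives, `n - 1` rounds reach the
whole graph, and any two modules are either completely joined or have no edges between them.

For each module the algorithm keeps the set of its profiles. The type of a color class is its size,
capped at `Δ + 1`, with its maximum degree; the profile of a coloring is the multiset of the `χ`
types. Names of colors are irrelevant, so a profile of a union amounts to a multiset of pairs of
types projecting to profiles of the two parts (`mem_profiles_union`). Each merge therefore
enumerates multisets of at most `χ` pairs out of `P = (Δ + 2) ^ 4`, uses those of size exactly `χ`,
and costs a polynomial factor times their number. That number is at most `(χ + 1) ^ P` (choose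
multiplicities) and at most `(P + 1) ^ χ` (choose the elements); `listBound` is the minimum.

If `Δ + 1 ≤ n ^ (1/5)`, then `P ≤ 16 * n ^ (4/5)` and the first bound suffices. Otherwise `χ ≤ n ^
(4/5)`, and the second bound suffices because `P + 1 ≤ n ^ 5` (`listBound_le`).

On the machine a profile is the number whose base `χ + 1` digits are multiplicities. All tables
share array `6`: the profile with code `k` of the module with identifier `a` is marked at address `a
+ 2 * n * k`. Identifiers stay below `2 * n`, so residues modulo `2 * n` separate the modules, and
codes add up along a multiset, which the enumeration maintains incrementally without multiplication.
-/

@[simp] theorem State.setReg_reg (s : State) (x v y : ℕ) :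
    (s.setReg x v).reg y = if y = x then v else s.reg y := by
  simp [State.setReg, Function.update_apply]

@[simp] theorem State.setReg_arr (s : State) (x v : ℕ) : (s.setReg x v).arr = s.arr := rfl

@[simp] theorem State.setArr_reg (s : State) (a i v : ℕ) : (s.setArr a i v).reg = s.reg := rfl

@[simp] theorem State.setArr_arr (s : State) (a i v b : ℕ) :
    (s.setArr a i v).arr b = if b = a then Function.update (s.arr a) i v else s.arr b := by
  simp [State.setArr, Function.update_apply]

/-- Whether a program has an instruction that writes to register `r`. -/
def Prog.writesReg : Prog → ℕ → Bool
  | .const x _, r => r == x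
  | .add x _ _, r => r == x
  | .sub x _ _, r => r == x
  | .load x _ _, r => r == x
  | .store _ _ _, _ => false
  | .seq p q, r => p.writesReg r || q.writesReg r
  | .ifLt _ _ p q, r => p.writesReg r || q.writesReg r
  | .whileLt _ _ p, r => p.writesReg r

/-- Whether a program has an instruction that writes to array `a`. -/
def Prog.writesArr : Prog → ℕ → Bool
  | .const _ _, _ => false
  | .add _ _ _, _ => false
  | .sub _ _ _, _ => false
  | .load _ _ _, _ => false
  | .store b _ _, a => a == b
  | .seq p q, a => p.writesArr a || q.writesArr a
  | .ifLt _ _ p q, a => p.writesArr a || q.writesArr a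
  | .whileLt _ _ p, a => p.writesArr a

/-- The states `s` and `s'` agree on everything that the program `p` does not write to. -/
structure Frame (p : Prog) (s s' : State) : Prop where
  reg : ∀ r, p.writesReg r = false → s'.reg r = s.reg r
  arr : ∀ a, p.writesArr a = false → s'.arr a = s.arr a

theorem Frame.refl (p : Prog) (s : State) : Frame p s s := ⟨fun _ _ => rfl, fun _ _ => rfl⟩

theorem Frame.trans {p : Prog} {s s₁ s₂ : State} (h : Frame p s s₁) (h' : Frame p s₁ s₂) :
    Frame p s s₂ :=
  ⟨fun r hr => (h'.reg r hr).trans (h.reg r hr), fun a ha => (h'.arr a ha).trans (h.arr a ha)⟩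

/-- Whether a program writes to a location is a computable syntactic check. Facts such as "register
`r` is unchanged" therefore reduce to a side condition that `rfl` decides, which is how all later
proofs carry data past a subprogram. -/
theorem Runs.frame {p : Prog} {s s' : State} {t : ℕ} (h : Runs p s t s') : Frame p s s' := by
  induction h with
  | const s x k => constructor <;> simp +contextual [Prog.writesReg, Prog.writesArr]
  | add s x y z => constructor <;> simp +contextual [Prog.writesReg, Prog.writesArr]
  | sub s x y z => constructor <;> simp +contextual [Prog.writesReg, Prog.writesArr]
  | load s x a y => constructor <;> simp +contextual [Prog.writesReg, Prog.writesArr]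
  | store s a x y => constructor <;> simp +contextual [Prog.writesReg, Prog.writesArr]
  | seq _ _ ih₁ ih₂ =>
    constructor
    · intro r hr
      simp only [Prog.writesReg, Bool.or_eq_false_iff] at hr
      rw [ih₂.reg r hr.2, ih₁.reg r hr.1]
    · intro r hr
      simp only [Prog.writesArr, Bool.or_eq_false_iff] at hr
      rw [ih₂.arr r hr.2, ih₁.arr r hr.1]
  | ifTrue _ _ ih =>
    constructor
    · intro r hr
      simp only [Prog.writesReg, Bool.or_eq_false_iff] at hr
      exact ih.reg r hr.1
    · intro r hr
      simp only [Prog.writesArr, Bool.or_eq_false_iff] at hr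
      exact ih.arr r hr.1
  | ifFalse _ _ ih =>
    constructor
    · intro r hr
      simp only [Prog.writesReg, Bool.or_eq_false_iff] at hr
      exact ih.reg r hr.2
    · intro r hr
      simp only [Prog.writesArr, Bool.or_eq_false_iff] at hr
      exact ih.arr r hr.2
  | whileTrue _ _ _ ih₁ ih₂ =>
    exact Frame.trans ⟨ih₁.reg, ih₁.arr⟩ ih₂
  | whileFalse _ => exact Frame.refl _ _

/-- Started in state `s`, the program `p` halts within `T` steps, in a state satisfying `Q`. -/
def Ends (p : Prog) (s : State) (T : ℕ) (Q : State → Prop) : Prop :=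
  ∃ (t : ℕ) (s' : State), Runs p s t s' ∧ t ≤ T ∧ Q s'

theorem Ends.mono {p : Prog} {s : State} {T T' : ℕ} {Q Q' : State → Prop} (h : Ends p s T Q)
    (hT : T ≤ T') (hQ : ∀ s', Frame p s s' → Q s' → Q' s') : Ends p s T' Q' := by
  obtain ⟨t, s', hr, ht, hs⟩ := h
  exact ⟨t, s', hr, ht.trans hT, hQ s' hr.frame hs⟩

theorem Ends.seq {p q : Prog} {s : State} {T₁ T₂ : ℕ} {Q₁ Q : State → Prop} (h : Ends p s T₁ Q₁)
    (h' : ∀ s₁, Frame p s s₁ → Q₁ s₁ → Ends q s₁ T₂ Q) : Ends (.seq p q) s (T₁ + T₂) Q := by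
  obtain ⟨t, s₁, hr, ht, hs⟩ := h
  obtain ⟨t', s', hr', ht', hs'⟩ := h' s₁ hr.frame hs
  exact ⟨t + t', s', hr.seq hr', add_le_add ht ht', hs'⟩

theorem Ends.ifLt {p q : Prog} {s : State} {x y T : ℕ} {Q : State → Prop}
    (h : s.reg x < s.reg y → Ends p s T Q) (h' : ¬ s.reg x < s.reg y → Ends q s T Q) :
    Ends (.ifLt x y p q) s (T + 1) Q := by
  by_cases hxy : s.reg x < s.reg y
  · obtain ⟨t, s', hr, ht, hs⟩ := h hxy
    exact ⟨1 + t, s', .ifTrue hxy hr, by omega, hs⟩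
  · obtain ⟨t, s', hr, ht, hs⟩ := h' hxy
    exact ⟨1 + t, s', .ifFalse hxy hr, by omega, hs⟩

/-- Whether a program has no loops. -/
def Prog.loopFree : Prog → Bool
  | .seq p q => p.loopFree && q.loopFree
  | .ifLt _ _ p q => p.loopFree && q.loopFree
  | .whileLt _ _ _ => false
  | _ => true

/-- The final state of a program without loops. -/
def Prog.exec : Prog → State → State
  | .const x k, s => s.setReg x k
  | .add x y z, s => s.setReg x (s.reg y + s.reg z)
  | .sub x y z, s => s.setReg x (s.reg y - s.reg z)
  | .load x a y, s => s.setReg x (s.arr a (s.reg y))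
  | .store a x y, s => s.setArr a (s.reg x) (s.reg y)
  | .seq p q, s => q.exec (p.exec s)
  | .ifLt x y p q, s => if s.reg x < s.reg y then p.exec s else q.exec s
  | .whileLt _ _ _, s => s

/-- The number of instructions of a program. -/
def Prog.size : Prog → ℕ
  | .seq p q => p.size + q.size
  | .ifLt _ _ p q => 1 + p.size + q.size
  | .whileLt _ _ p => 1 + p.size
  | _ => 1

/-- Straight-line code is handled by evaluation: its final state is the term `p.exec s`, which
`simp` can compute, and its running time is at most its length. -/
theorem Prog.exists_runs_exec (p : Prog) (hp : p.loopFree = true) (s : State) :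
    ∃ t ≤ p.size, Runs p s t (p.exec s) := by
  induction p generalizing s with
  | const x k => exact ⟨1, le_rfl, .const s x k⟩
  | add x y z => exact ⟨1, le_rfl, .add s x y z⟩
  | sub x y z => exact ⟨1, le_rfl, .sub s x y z⟩
  | load x a y => exact ⟨1, le_rfl, .load s x a y⟩
  | store a x y => exact ⟨1, le_rfl, .store s a x y⟩
  | seq p q ihp ihq =>
    simp only [Prog.loopFree, Bool.and_eq_true] at hp
    obtain ⟨t, ht, h⟩ := ihp hp.1 s
    obtain ⟨t', ht', h'⟩ := ihq hp.2 (p.exec s)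
    exact ⟨t + t', add_le_add ht ht', h.seq h'⟩
  | ifLt x y p q ihp ihq =>
    simp only [Prog.loopFree, Bool.and_eq_true] at hp
    simp only [Prog.exec, Prog.size]
    split_ifs with hxy
    · obtain ⟨t, ht, h⟩ := ihp hp.1 s
      exact ⟨1 + t, by omega, .ifTrue hxy h⟩
    · obtain ⟨t, ht, h⟩ := ihq hp.2 s
      exact ⟨1 + t, by omega, .ifFalse hxy h⟩
  | whileLt x y p => simp [Prog.loopFree] at hp

theorem Ends.of_loopFree {p : Prog} {s : State} {T : ℕ} {Q : State → Prop}
    (hp : p.loopFree = true) (hT : p.size ≤ T) (hQ : Q (p.exec s)) : Ends p s T Q := by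
  obtain ⟨t, ht, h⟩ := p.exists_runs_exec hp s
  exact ⟨t, _, h, ht.trans hT, hQ⟩

/-- The loop that runs `p` with register `i` going from `0` up to the content of register `b`
(excluded). Register `3` is scratch space. -/
def forTo (i b : ℕ) (p : Prog) : Prog :=
  .seq (.const i 0) (.whileLt i b (.seq p (.seq (.const 3 1) (.add i i 3))))

/-- The loop rule. The invariant is required after the counter update, so it has to survive the
writes to register `3` and to `i`. Each iteration costs `T` plus three steps (test, constant,
increment); the extra two are the initialization of `i` and the final failing test. -/
theorem Ends.forTo {i b : ℕ} {p : Prog} {s : State} {N T : ℕ} (Inv : ℕ → State → Prop)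
    (hN : s.reg b = N) (hb : (DefectiveColoring.forTo i b p).writesReg b = false)
    (hi : p.writesReg i = false) (hi3 : i ≠ 3)
    (zero : Inv 0 (s.setReg i 0))
    (step : ∀ k s₁, k < N → s₁.reg i = k → Frame (DefectiveColoring.forTo i b p) s s₁ →
      Inv k s₁ → Ends p s₁ T fun s₂ => Inv (k + 1) ((s₂.setReg 3 1).setReg i (k + 1))) :
    Ends (DefectiveColoring.forTo i b p) s (N * (T + 3) + 2) (Inv N) := by
  set L := DefectiveColoring.forTo i b p with hL
  have hbne : b ≠ i ∧ b ≠ 3 ∧ p.writesReg b = false := by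
    simp only [hL, DefectiveColoring.forTo, Prog.writesReg, Bool.or_eq_false_iff, beq_eq_false_iff_ne] at hb
    tauto
  -- Induction on the number `d` of iterations that remain.
  have loop : ∀ d k s₁, k + d = N → s₁.reg i = k → Frame L s s₁ → Inv k s₁ →
      Ends (.whileLt i b (.seq p (.seq (.const 3 1) (.add i i 3)))) s₁ (d * (T + 3) + 1)
        (Inv N) := by
    intro d
    induction d with
    | zero =>
      intro k s₁ hk hi' hf hI
      have hb' : s₁.reg b = N := by rw [hf.reg b hb, hN]
      refine ⟨1, s₁, .whileFalse (by omega), by omega, ?_⟩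
      have : k = N := by omega
      exact this ▸ hI
    | succ d ih =>
      intro k s₁ hk hi' hf hI
      have hb' : s₁.reg b = N := by rw [hf.reg b hb, hN]
      obtain ⟨t, s₂, hr, ht, hI'⟩ := step k s₁ (by omega) hi' hf hI
      have hr' : Runs (.seq p (.seq (.const 3 1) (.add i i 3))) s₁ (t + (1 + 1))
          ((s₂.setReg 3 1).setReg i (k + 1)) := by
        refine hr.seq ((Runs.const s₂ 3 1).seq ?_)
        have := Runs.add (s₂.setReg 3 1) i i 3
        simpa [hi3, hr.frame.reg i hi, hi'] using this
      have hf' : Frame L s ((s₂.setReg 3 1).setReg i (k + 1)) := by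
        refine hf.trans ⟨fun r hr₀ => hr'.frame.reg r ?_, fun a ha => hr'.frame.arr a ?_⟩
        · simp only [hL, DefectiveColoring.forTo, Prog.writesReg, Bool.or_eq_false_iff] at hr₀ ⊢
          tauto
        · simpa [hL, DefectiveColoring.forTo, Prog.writesArr] using ha
      obtain ⟨t', s', hr'', ht', hQ⟩ := ih (k + 1) _ (by omega) (by simp) hf' hI'
      refine ⟨1 + (t + (1 + 1)) + t', s', .whileTrue (by omega) hr' hr'', ?_, hQ⟩
      rw [add_mul]; omega
  obtain ⟨t, s', hr, ht, hQ⟩ := loop N 0 (s.setReg i 0) (by omega) (by simp)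
    ⟨fun r hr => by
        have : r ≠ i := by
          rintro rfl
          simp [hL, DefectiveColoring.forTo, Prog.writesReg] at hr
        simp [this], fun a _ => rfl⟩ zero
  exact ⟨1 + t, s', (Runs.const s i 0).seq hr, by omega, hQ⟩

/-- Register `z` := register `x` * register `y`. Registers `3` and `5` are scratch space. -/
def mulProg (z x y : ℕ) : Prog := .seq (.const z 0) (forTo 5 y (.add z z x))

/-- Multiplication is repeated addition, four steps per unit of the second factor, so the second
factor must always be small. -/
theorem Ends.mul {z x y : ℕ} {s : State} (hx : (mulProg z x y).writesReg x = false)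
    (hy : (mulProg z x y).writesReg y = false) (hz : z ≠ 3 ∧ z ≠ 5) :
    Ends (mulProg z x y) s (s.reg y * 4 + 3) fun s' => s'.reg z = s.reg x * s.reg y := by
  have hxz : x ≠ z ∧ x ≠ 3 ∧ x ≠ 5 := by
    simp [mulProg, DefectiveColoring.forTo, Prog.writesReg] at hx
    tauto
  have hyz : y ≠ z ∧ y ≠ 3 ∧ y ≠ 5 := by
    simp [mulProg, DefectiveColoring.forTo, Prog.writesReg] at hy
    tauto
  refine (Ends.seq (T₁ := 1) (T₂ := s.reg y * 4 + 2) (Q₁ := fun s' => s' = s.setReg z 0)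
    (Ends.of_loopFree rfl le_rfl rfl) ?_).mono (by omega) (fun _ _ h => h)
  rintro _ - rfl
  refine Ends.forTo (T := 1) (fun k s' => s'.reg z = s.reg x * k) ?_ ?_ ?_ (by norm_num) ?_ ?_
  · simp [hyz]
  · simp [DefectiveColoring.forTo, Prog.writesReg, hyz]
  · simp only [Prog.writesReg, beq_eq_false_iff_ne]
    exact hz.2.symm
  · simp [hz]
  · intro k s₁ _ _ hf hI
    refine Ends.of_loopFree rfl le_rfl ?_
    have := hf.reg x (by simp [DefectiveColoring.forTo, Prog.writesReg, hxz])
    simp [Prog.exec, hz, hI, this, hxz, mul_add]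

/-! ### Twins in cographs -/

/-- If `S` has two elements on one side of a union or join, twins come from that side by induction:
a vertex of the other side is adjacent to all of it or to none of it. Otherwise `S` has one element
on each side, and these two are twins vacuously. Stating this for subsets `S` avoids a separate
closure of cographs under induced subgraphs. -/
theorem IsCograph.exists_twins {V : Type} {G : SimpleGraph V} (h : IsCograph G) :
    ∀ S : Set V, S.Nontrivial → ∃ x ∈ S, ∃ y ∈ S, x ≠ y ∧
      ∀ z ∈ S, z ≠ x → z ≠ y → (G.Adj x z ↔ G.Adj y z) := by
  induction h with
  | single G =>
    rintro S ⟨x, _, y, _, hxy⟩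
    exact absurd (Subsingleton.elim x y) hxy
  | @disjUnion V W G H _ _ ihG ihH =>
    intro S hS
    by_cases h₁ : (Sum.inl ⁻¹' S : Set V).Nontrivial
    · obtain ⟨x, hx, y, hy, hxy, h⟩ := ihG _ h₁
      refine ⟨.inl x, hx, .inl y, hy, by simpa using hxy, ?_⟩
      rintro (z | z) hz hzx hzy
      · simpa using h z hz (by simpa using hzx) (by simpa using hzy)
      · simp
    by_cases h₂ : (Sum.inr ⁻¹' S : Set W).Nontrivial
    · obtain ⟨x, hx, y, hy, hxy, h⟩ := ihH _ h₂
      refine ⟨.inr x, hx, .inr y, hy, by simpa using hxy, ?_⟩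
      rintro (z | z) hz hzx hzy
      · simp
      · simpa using h z hz (by simpa using hzx) (by simpa using hzy)
    rw [Set.not_nontrivial_iff] at h₁ h₂
    obtain ⟨x, hx, y, hy, hxy⟩ := hS
    refine ⟨x, hx, y, hy, hxy, fun z hz hzx hzy => ?_⟩
    -- A third vertex of `S` would share a side with `x` or `y`.
    exfalso
    rcases x with x | x <;> rcases y with y | y <;> rcases z with z | z
    all_goals first
      | exact hxy (congrArg _ (h₁ hx hy))
      | exact hxy (congrArg _ (h₂ hx hy))
      | exact hzx (congrArg _ (h₁ hz hx))
      | exact hzx (congrArg _ (h₂ hz hx))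
      | exact hzy (congrArg _ (h₁ hz hy))
      | exact hzy (congrArg _ (h₂ hz hy))
  | @join V W G H _ _ ihG ihH =>
    intro S hS
    by_cases h₁ : (Sum.inl ⁻¹' S : Set V).Nontrivial
    · obtain ⟨x, hx, y, hy, hxy, h⟩ := ihG _ h₁
      refine ⟨.inl x, hx, .inl y, hy, by simpa using hxy, ?_⟩
      rintro (z | z) hz hzx hzy
      · simpa using h z hz (by simpa using hzx) (by simpa using hzy)
      · simp
    by_cases h₂ : (Sum.inr ⁻¹' S : Set W).Nontrivial
    · obtain ⟨x, hx, y, hy, hxy, h⟩ := ihH _ h₂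
      refine ⟨.inr x, hx, .inr y, hy, by simpa using hxy, ?_⟩
      rintro (z | z) hz hzx hzy
      · simp
      · simpa using h z hz (by simpa using hzx) (by simpa using hzy)
    rw [Set.not_nontrivial_iff] at h₁ h₂
    obtain ⟨x, hx, y, hy, hxy⟩ := hS
    refine ⟨x, hx, y, hy, hxy, fun z hz hzx hzy => ?_⟩
    exfalso
    rcases x with x | x <;> rcases y with y | y <;> rcases z with z | z
    all_goals first
      | exact hxy (congrArg _ (h₁ hx hy))
      | exact hxy (congrArg _ (h₂ hx hy))
      | exact hzx (congrArg _ (h₁ hz hx))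
      | exact hzx (congrArg _ (h₂ hz hx))
      | exact hzy (congrArg _ (h₁ hz hy))
      | exact hzy (congrArg _ (h₂ hz hy))
  | @iso V W G H e _ ih =>
    rintro S ⟨a, ha, b, hb, hab⟩
    obtain ⟨x, hx, y, hy, hxy, h⟩ := ih (e ⁻¹' S)
      ⟨e.symm a, by simpa using ha, e.symm b, by simpa using hb, by simpa using hab⟩
    refine ⟨e x, hx, e y, hy, by simpa using hxy, fun z hz hzx hzy => ?_⟩
    have := h (e.symm z) (by simpa using hz) (by rintro rfl; simp at hzx)
      (by rintro rfl; simp at hzy)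
    rw [← e.map_adj_iff, ← e.map_adj_iff] at this
    simpa using this

/-! ### Profiles of colorings -/

open Finset

open Classical in
/-- The number of vertices of color `i` in `M`. -/
noncomputable def classSize {V : Type} {χ : ℕ} (M : Finset V) (c : V → Fin χ) (i : Fin χ) : ℕ :=
  #{v ∈ M | c v = i}

open Classical in
/-- The maximum degree of the subgraph induced by the vertices of color `i` in `M`. -/
noncomputable def classDeg {V : Type} {χ : ℕ} (G : SimpleGraph V) (M : Finset V) (c : V → Fin χ)
    (i : Fin χ) : ℕ :=
  {v ∈ M | c v = i}.sup fun v => #{w ∈ M | c w = i ∧ G.Adj v w}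

/-- The number that stands for the size and the maximum degree of color class `i` in `M`, where
sizes above `Δ` count as `Δ + 1`. -/
noncomputable def classType {V : Type} {χ : ℕ} (G : SimpleGraph V) (Δ : ℕ) (M : Finset V)
    (c : V → Fin χ) (i : Fin χ) : ℕ :=
  min (classSize M c i) (Δ + 1) * (Δ + 2) + classDeg G M c i

/-- The multisets of class types of the `(χ, Δ)`-colorings of the subgraph induced by `M`. -/
def profiles {V : Type} (G : SimpleGraph V) (χ Δ : ℕ) (M : Finset V) : Set (Multiset ℕ) :=
  {μ | ∃ c : V → Fin χ, (∀ i, classDeg G M c i ≤ Δ) ∧ univ.val.map (classType G Δ M c) = μ}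

/-- Two different colors `i` and `j` are allowed so that the lemma covers permutations of the
colors. -/
theorem classSize_congr {V : Type} {χ : ℕ} {M : Finset V} {c c' : V → Fin χ} {i j : Fin χ}
    (h : ∀ v ∈ M, c v = i ↔ c' v = j) : classSize M c i = classSize M c' j := by
  classical
  unfold classSize
  congr 1
  exact filter_congr h

theorem classDeg_congr {V : Type} {χ : ℕ} {G : SimpleGraph V} {M : Finset V} {c c' : V → Fin χ}
    {i j : Fin χ} (h : ∀ v ∈ M, c v = i ↔ c' v = j) : classDeg G M c i = classDeg G M c' j := by
  classical
  unfold classDeg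
  rw [filter_congr h]
  refine sup_congr rfl fun v _ => ?_
  congr 1
  exact filter_congr fun w hw => by rw [h w hw]

theorem sup_add_const {α : Type*} (s : Finset α) (hs : s.Nonempty) (f : α → ℕ) (k : ℕ) :
    (s.sup fun v => f v + k) = s.sup f + k := by
  apply le_antisymm
  · exact Finset.sup_le fun v hv => Nat.add_le_add_right (le_sup (f := f) hv) k
  · obtain ⟨v, hv, h⟩ := exists_mem_eq_sup s hs f
    rw [h]
    exact le_sup (f := fun v => f v + k) hv

/-! ### Color classes in the union of two modules -/

theorem classSize_union {V : Type} [DecidableEq V] {χ : ℕ} {M N : Finset V} (hMN : Disjoint M N)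
    (c : V → Fin χ) (i : Fin χ) :
    classSize (M ∪ N) c i = classSize M c i + classSize N c i := by
  classical
  unfold classSize
  rw [filter_union, card_union_of_disjoint]
  exact disjoint_filter_filter hMN

/-- Under a join every vertex of the class gains all class members of the other side as neighbors.
The positivity conditions are needed because the supremum over an empty class is `0` and must not be
shifted. -/
theorem classDeg_union {V : Type} [DecidableEq V] {χ : ℕ} {G : SimpleGraph V} {M N : Finset V}
    (hMN : Disjoint M N) {op : Prop} [Decidable op] (hop : ∀ u ∈ M, ∀ v ∈ N, G.Adj u v ↔ op)
    (c : V → Fin χ) (i : Fin χ) :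
    classDeg G (M ∪ N) c i = if op ∧ 0 < classSize M c i ∧ 0 < classSize N c i
      then max (classDeg G M c i + classSize N c i) (classDeg G N c i + classSize M c i)
      else max (classDeg G M c i) (classDeg G N c i) := by
  classical
  -- The degrees of the vertices on one side only; used for both orders of `M` and `N`.
  have key : ∀ A B : Finset V, Disjoint A B → (∀ u ∈ A, ∀ v ∈ B, G.Adj u v ↔ op) →
      ({v ∈ A | c v = i}.sup fun v => #{w ∈ A ∪ B | c w = i ∧ G.Adj v w}) =
        if op ∧ 0 < classSize A c i then classDeg G A c i + classSize B c i
        else classDeg G A c i := by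
    intro A B hAB h
    have h₁ : ∀ v ∈ {v ∈ A | c v = i}, #{w ∈ A ∪ B | c w = i ∧ G.Adj v w} =
        #{w ∈ A | c w = i ∧ G.Adj v w} + if op then classSize B c i else 0 := by
      intro v hv
      rw [filter_union, card_union_of_disjoint (disjoint_filter_filter hAB)]
      congr 1
      split_ifs with ho
      · unfold classSize
        congr 1
        refine filter_congr fun w hw => ?_
        simp [h v (mem_filter.1 hv).1 w hw, ho]
      · rw [card_eq_zero, filter_eq_empty_iff]
        intro w hw
        simp [h v (mem_filter.1 hv).1 w hw, ho]
    rw [sup_congr rfl h₁]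
    unfold classDeg
    by_cases hne : {v ∈ A | c v = i}.Nonempty
    · rw [sup_add_const _ hne]
      have : 0 < classSize A c i := card_pos.2 hne
      simp only [this, and_true]
      split_ifs <;> simp
    · have h0 : classSize A c i = 0 := by
        unfold classSize
        rw [card_eq_zero]
        exact not_nonempty_iff_eq_empty.1 hne
      rw [not_nonempty_iff_eq_empty] at hne
      simp [h0, hne]
  have k₁ := key M N hMN hop
  have k₂ := key N M hMN.symm fun u hu v hv => by rw [G.adj_comm]; exact hop v hv u hu
  rw [union_comm N M] at k₂
  rw [classDeg, filter_union, sup_union, k₁, k₂]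
  by_cases ho : op
  swap
  · simp [ho]
  have hz : ∀ A : Finset V, classSize A c i = 0 → classDeg G A c i = 0 := by
    intro A h
    unfold classSize at h
    unfold classDeg
    rw [card_eq_zero] at h
    simp [h]
  rcases Nat.eq_zero_or_pos (classSize M c i) with h₁ | h₁ <;>
    rcases Nat.eq_zero_or_pos (classSize N c i) with h₂ | h₂ <;> simp [ho, h₁, h₂]

/-- The size coordinate of a union of two color classes with types `t` and `u`. -/
def combSize (Δ t u : ℕ) : ℕ := min (t / (Δ + 2) + u / (Δ + 2)) (Δ + 1)

open Classical in
/-- The degree coordinate of a union of two color classes with types `t` and `u`, where `op` says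
whether the two sides are completely joined. -/
noncomputable def combDeg (Δ : ℕ) (op : Prop) (t u : ℕ) : ℕ :=
  if op ∧ 0 < t / (Δ + 2) ∧ 0 < u / (Δ + 2)
  then max (t % (Δ + 2) + u / (Δ + 2)) (u % (Δ + 2) + t / (Δ + 2))
  else max (t % (Δ + 2)) (u % (Δ + 2))

/-- The type of a union of two color classes with types `t` and `u`. -/
noncomputable def combType (Δ : ℕ) (op : Prop) (t u : ℕ) : ℕ :=
  combSize Δ t u * (Δ + 2) + combDeg Δ op t u

/-- Capped sizes are at most `Δ + 1` and degrees at most `Δ`, so both are digits in base `Δ + 2` and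
can be read off the type. -/
theorem classType_div {V : Type} {χ : ℕ} {G : SimpleGraph V} {Δ : ℕ} {M : Finset V}
    {c : V → Fin χ} {i : Fin χ} (h : classDeg G M c i ≤ Δ) :
    classType G Δ M c i / (Δ + 2) = min (classSize M c i) (Δ + 1) := by
  rw [classType, mul_comm, Nat.mul_add_div (by omega), Nat.div_eq_of_lt (by omega), add_zero]

theorem classType_mod {V : Type} {χ : ℕ} {G : SimpleGraph V} {Δ : ℕ} {M : Finset V}
    {c : V → Fin χ} {i : Fin χ} (h : classDeg G M c i ≤ Δ) :
    classType G Δ M c i % (Δ + 2) = classDeg G M c i := by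
  rw [classType, mul_comm, Nat.mul_add_mod, Nat.mod_eq_of_lt (by omega)]

theorem classType_lt {V : Type} {χ : ℕ} {G : SimpleGraph V} {Δ : ℕ} {M : Finset V}
    {c : V → Fin χ} {i : Fin χ} (h : classDeg G M c i ≤ Δ) :
    classType G Δ M c i < (Δ + 2) * (Δ + 2) := by
  have h₁ := classType_div h
  rw [← Nat.div_lt_iff_lt_mul (by omega), h₁]
  omega

/-- Capping sizes at `Δ + 1` loses nothing: in a join, a nonempty class meeting a class of size
above `Δ` on the other side already violates the degree bound, and if the bound holds then neither
size was capped. -/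
theorem classDeg_union_le_iff {V : Type} [DecidableEq V] {χ Δ : ℕ} {G : SimpleGraph V}
    {M N : Finset V} (hMN : Disjoint M N) {op : Prop} (hop : ∀ u ∈ M, ∀ v ∈ N, G.Adj u v ↔ op)
    {c : V → Fin χ} {i : Fin χ} (hM : classDeg G M c i ≤ Δ) (hN : classDeg G N c i ≤ Δ) :
    (classDeg G (M ∪ N) c i ≤ Δ ↔
        combDeg Δ op (classType G Δ M c i) (classType G Δ N c i) ≤ Δ) ∧
      (classDeg G (M ∪ N) c i ≤ Δ → classType G Δ (M ∪ N) c i =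
        combType Δ op (classType G Δ M c i) (classType G Δ N c i)) := by
  classical
  rw [combType, combSize, combDeg, classType_div hM, classType_div hN, classType_mod hM,
    classType_mod hN]
  conv in classType G Δ (M ∪ N) c i => unfold classType
  rw [classDeg_union hMN hop, classSize_union hMN]
  generalize classDeg G M c i = d₁ at *
  generalize classDeg G N c i = d₂ at *
  generalize classSize M c i = s₁
  generalize classSize N c i = s₂
  -- Capping the summands first does not change the capped sum.
  have e : min (s₁ + s₂) (Δ + 1) = min (min s₁ (Δ + 1) + min s₂ (Δ + 1)) (Δ + 1) := by omega
  rw [e]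
  have e₁ : 0 < min s₁ (Δ + 1) ↔ 0 < s₁ := by omega
  have e₂ : 0 < min s₂ (Δ + 1) ↔ 0 < s₂ := by omega
  simp only [e₁, e₂]
  split_ifs
  · refine ⟨by omega, fun h => ?_⟩
    congr 1
    omega
  · exact ⟨Iff.rfl, fun _ => rfl⟩

theorem classDeg_mono {V : Type} {χ : ℕ} (G : SimpleGraph V) {M N : Finset V} (h : M ⊆ N)
    (c : V → Fin χ) (i : Fin χ) : classDeg G M c i ≤ classDeg G N c i := by
  classical
  unfold classDeg
  refine Finset.sup_le fun v hv => ?_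
  refine (card_le_card (filter_subset_filter _ h)).trans ?_
  exact le_sup (f := fun v => #{w ∈ N | c w = i ∧ G.Adj v w}) (filter_subset_filter _ h hv)

/-! ### Combining profiles of two modules -/

/-- Equal multisets of values mean that corresponding fibers have equal cardinality; bijections
between the fibers glue to a permutation. -/
theorem exists_perm_of_map_univ_eq {ι α : Type*} [Fintype ι] {f g : ι → α}
    (h : univ.val.map f = univ.val.map g) : ∃ σ : Equiv.Perm ι, ∀ i, f (σ i) = g i := by
  classical
  have hc : ∀ y, Fintype.card {i // g i = y} = Fintype.card {i // f i = y} := by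
    intro y
    have := congrArg (Multiset.count y) h
    rw [Multiset.count_map, Multiset.count_map] at this
    rw [Fintype.card_subtype, Fintype.card_subtype, card_def, card_def, filter_val, filter_val]
    simpa only [eq_comm] using this.symm
  let e : ∀ y, {i // g i = y} ≃ {i // f i = y} := fun y => Fintype.equivOfCardEq (hc y)
  refine ⟨(Equiv.sigmaFiberEquiv g).symm.trans
    ((Equiv.sigmaCongrRight e).trans (Equiv.sigmaFiberEquiv f)), fun i => ?_⟩
  exact (e (g i) ⟨i, rfl⟩).2

theorem exists_map_univ_eq {α : Type*} {χ : ℕ} {ν : Multiset α} (h : Multiset.card ν = χ) :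
    ∃ g : Fin χ → α, univ.val.map g = ν := by
  induction ν using Quotient.inductionOn with
  | _ l =>
    subst h
    refine ⟨fun i => l.get i, ?_⟩
    change univ.val.map (fun i : Fin l.length => l.get i) = (l : Multiset α)
    rw [Fin.univ_val_map, List.ofFn_get]

theorem card_of_mem_profiles {V : Type} {G : SimpleGraph V} {χ Δ : ℕ} {M : Finset V}
    {μ : Multiset ℕ} (h : μ ∈ profiles G χ Δ M) : Multiset.card μ = χ := by
  obtain ⟨c, _, rfl⟩ := h
  simp

theorem lt_of_mem_profiles {V : Type} {G : SimpleGraph V} {χ Δ : ℕ} {M : Finset V}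
    {μ : Multiset ℕ} (h : μ ∈ profiles G χ Δ M) : ∀ t ∈ μ, t < (Δ + 2) * (Δ + 2) := by
  obtain ⟨c, hc, rfl⟩ := h
  intro t ht
  obtain ⟨i, _, rfl⟩ := Multiset.mem_map.1 ht
  exact classType_lt (hc i)

/-- A coloring of the union pairs, color by color, a type in `M` with a type in `N`. Conversely,
given a multiset of pairs with the right projections, the colors of the two partial colorings can be
permuted independently until color `i` carries the `i`-th pair on both sides. -/
theorem mem_profiles_union {V : Type} [DecidableEq V] {χ Δ : ℕ} {G : SimpleGraph V}
    {M N : Finset V} (hMN : Disjoint M N) {op : Prop} (hop : ∀ u ∈ M, ∀ v ∈ N, G.Adj u v ↔ op)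
    {μ : Multiset ℕ} :
    μ ∈ profiles G χ Δ (M ∪ N) ↔ ∃ ν : Multiset (ℕ × ℕ), (∀ p ∈ ν, combDeg Δ op p.1 p.2 ≤ Δ) ∧
      ν.map Prod.fst ∈ profiles G χ Δ M ∧ ν.map Prod.snd ∈ profiles G χ Δ N ∧
      ν.map (fun p => combType Δ op p.1 p.2) = μ := by
  constructor
  · rintro ⟨c, hc, rfl⟩
    have h₁ i : classDeg G M c i ≤ Δ := (classDeg_mono G subset_union_left c i).trans (hc i)
    have h₂ i : classDeg G N c i ≤ Δ := (classDeg_mono G subset_union_right c i).trans (hc i)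
    refine ⟨univ.val.map fun i => (classType G Δ M c i, classType G Δ N c i), ?_,
      ⟨c, h₁, ?_⟩, ⟨c, h₂, ?_⟩, ?_⟩
    · intro p hp
      obtain ⟨i, _, rfl⟩ := Multiset.mem_map.1 hp
      exact (classDeg_union_le_iff hMN hop (h₁ i) (h₂ i)).1.1 (hc i)
    · simp [Function.comp_def]
    · simp [Function.comp_def]
    · rw [Multiset.map_map]
      refine Multiset.map_congr rfl fun i _ => ?_
      exact ((classDeg_union_le_iff hMN hop (h₁ i) (h₂ i)).2 (hc i)).symm
  · rintro ⟨ν, hν, h₁, h₂, rfl⟩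
    have hcard : Multiset.card ν = χ := by simpa using card_of_mem_profiles h₁
    obtain ⟨g, rfl⟩ := exists_map_univ_eq hcard
    obtain ⟨c₁, hc₁, e₁⟩ := h₁
    obtain ⟨c₂, hc₂, e₂⟩ := h₂
    rw [Multiset.map_map] at e₁ e₂
    obtain ⟨σ, hσ⟩ := exists_perm_of_map_univ_eq e₁
    obtain ⟨τ, hτ⟩ := exists_perm_of_map_univ_eq e₂
    -- `σ` and `τ` send `i` to the color whose class has the type prescribed by `g i`, so the colors
    -- are renamed by their inverses.
    let c : V → Fin χ := fun v => if v ∈ M then σ.symm (c₁ v) else τ.symm (c₂ v)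
    have k₁ i : ∀ v ∈ M, c v = i ↔ c₁ v = σ i := by
      intro v hv
      simp [c, hv, Equiv.symm_apply_eq]
    have k₂ i : ∀ v ∈ N, c v = i ↔ c₂ v = τ i := by
      intro v hv
      have : v ∉ M := fun h => disjoint_left.1 hMN h hv
      simp [c, this, Equiv.symm_apply_eq]
    have t₁ i : classType G Δ M c i = (g i).1 := by
      rw [classType, classDeg_congr (k₁ i), classSize_congr (k₁ i)]
      exact hσ i
    have t₂ i : classType G Δ N c i = (g i).2 := by
      rw [classType, classDeg_congr (k₂ i), classSize_congr (k₂ i)]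
      exact hτ i
    have d₁ i : classDeg G M c i ≤ Δ := by rw [classDeg_congr (k₁ i)]; exact hc₁ _
    have d₂ i : classDeg G N c i ≤ Δ := by rw [classDeg_congr (k₂ i)]; exact hc₂ _
    have hd i : classDeg G (M ∪ N) c i ≤ Δ := by
      rw [(classDeg_union_le_iff hMN hop (d₁ i) (d₂ i)).1, t₁, t₂]
      exact hν _ (Multiset.mem_map_of_mem g (mem_univ_val i))
    refine ⟨c, hd, ?_⟩
    rw [Multiset.map_map]
    refine Multiset.map_congr rfl fun i _ => ?_
    rw [(classDeg_union_le_iff hMN hop (d₁ i) (d₂ i)).2 (hd i), t₁, t₂]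
    rfl

theorem colorable_iff_profiles_nonempty {V : Type} [Fintype V] {G : SimpleGraph V} {χ Δ : ℕ} :
    Colorable G χ Δ ↔ (profiles G χ Δ univ).Nonempty := by
  classical
  have key : ∀ (c : V → Fin χ) i,
      (G.induce (c ⁻¹' {i})).maxDegree ≤ Δ ↔ classDeg G univ c i ≤ Δ := by
    intro c i
    have hdeg : ∀ v : c ⁻¹' {i}, (G.induce (c ⁻¹' {i})).degree v =
        #{w ∈ univ | c w = i ∧ G.Adj v w} := by
      intro v
      rw [← SimpleGraph.card_neighborFinset_eq_degree]
      refine card_bij (fun w _ => w.1) ?_ ?_ ?_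
      · intro w hw
        have h : c w = i := w.2
        simpa [h] using hw
      · intro a _ b _ h
        exact Subtype.ext h
      · intro w hw
        simp only [mem_filter, mem_univ, true_and] at hw
        exact ⟨⟨w, hw.1⟩, by simpa using hw.2, rfl⟩
    constructor
    · intro h
      refine Finset.sup_le fun v hv => ?_
      simp only [mem_filter, mem_univ, true_and] at hv
      rw [← hdeg ⟨v, hv⟩]
      exact (SimpleGraph.degree_le_maxDegree _ _).trans h
    · intro h
      refine SimpleGraph.maxDegree_le_of_forall_degree_le _ _ fun v => ?_
      rw [hdeg v]
      refine le_trans ?_ h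
      exact le_sup (f := fun v => #{w ∈ (univ : Finset V) | c w = i ∧ G.Adj v w})
        (by simpa using (show c v = i from v.2))
  constructor
  · rintro ⟨c, hc⟩
    refine ⟨_, c, fun i => (key c i).1 ?_, rfl⟩
    convert hc i
  · rintro ⟨_, c, hc, -⟩
    refine ⟨c, fun i => ?_⟩
    have := (key c i).2 (hc i)
    convert this

/-- One class has size `1` and degree `0`, which is encoded as `1 * (Δ + 2) + 0`; the other `χ - 1`
classes are empty and have type `0`. -/
theorem profiles_singleton {V : Type} (G : SimpleGraph V) {χ Δ : ℕ} (hχ : 1 ≤ χ) (v : V) :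
    profiles G χ Δ {v} = {(Δ + 2) ::ₘ Multiset.replicate (χ - 1) 0} := by
  classical
  have hsize : ∀ (c : V → Fin χ) i, classSize {v} c i = if i = c v then 1 else 0 := by
    intro c i
    unfold classSize
    rw [filter_singleton]
    by_cases h : i = c v
    · simp [h]
    · simp [h, Ne.symm h]
  have hdeg : ∀ (c : V → Fin χ) i, classDeg G {v} c i = 0 := by
    intro c i
    unfold classDeg
    rw [← Nat.le_zero]
    refine Finset.sup_le fun w hw => ?_
    simp only [mem_filter, mem_singleton] at hw
    obtain ⟨rfl, -⟩ := hw
    simp [filter_singleton]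
  have hprof : ∀ c : V → Fin χ, univ.val.map (classType G Δ {v} c) =
      (Δ + 2) ::ₘ Multiset.replicate (χ - 1) 0 := by
    intro c
    have : (univ : Finset (Fin χ)).val = c v ::ₘ (univ.erase (c v)).val := by
      rw [← insert_val_of_notMem (notMem_erase _ _), insert_erase (mem_univ _)]
    rw [this, Multiset.map_cons]
    congr 1
    · simp [classType, hsize, hdeg]
    · rw [Multiset.eq_replicate]
      constructor
      · simp
      · intro t ht
        obtain ⟨i, hi, rfl⟩ := Multiset.mem_map.1 ht
        have : i ≠ c v := by
          have : i ∈ univ.erase (c v) := hi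
          exact (mem_erase.1 this).1
        simp [classType, hsize, hdeg, this]
  ext μ
  simp only [Set.mem_singleton_iff]
  constructor
  · rintro ⟨c, -, rfl⟩
    exact hprof c
  · rintro rfl
    exact ⟨fun _ => ⟨0, hχ⟩, fun i => by rw [hdeg]; omega, hprof _⟩

/-- Color the vertices in blocks of `Δ + 1` consecutive numbers. A class has at most `Δ + 1`
vertices, hence degrees at most `Δ`, whatever the edges are. -/
theorem colorable_of_le_mul {n : ℕ} (G : SimpleGraph (Fin n)) {χ Δ : ℕ} (h : n ≤ χ * (Δ + 1)) :
    Colorable G χ Δ := by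
  classical
  have hlt : ∀ v : Fin n, (v : ℕ) / (Δ + 1) < χ := fun v => by
    rw [Nat.div_lt_iff_lt_mul (by omega)]
    exact v.2.trans_le h
  refine ⟨fun v => ⟨v / (Δ + 1), hlt v⟩, fun i => ?_⟩
  refine SimpleGraph.maxDegree_le_of_forall_degree_le _ _ fun v => ?_
  have h₁ := SimpleGraph.degree_lt_card_verts
    (G := G.induce ((fun v : Fin n => (⟨v / (Δ + 1), hlt v⟩ : Fin χ)) ⁻¹' {i})) v
  have h₂ : Fintype.card ((fun v : Fin n => (⟨v / (Δ + 1), hlt v⟩ : Fin χ)) ⁻¹' {i} : Set _) ≤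
      Δ + 1 := by
    refine (Fintype.card_le_of_injective (β := Fin (Δ + 1))
      (fun w => ⟨w.1 % (Δ + 1), Nat.mod_lt _ (by omega)⟩) ?_).trans (Fintype.card_fin _).le
    rintro ⟨a, ha⟩ ⟨b, hb⟩ hab
    simp only [Set.mem_preimage, Set.mem_singleton_iff, Fin.ext_iff] at ha hb
    simp only [Fin.mk.injEq] at hab
    apply Subtype.ext
    apply Fin.ext
    simp only
    rw [← Nat.div_add_mod (a : ℕ) (Δ + 1), ← Nat.div_add_mod (b : ℕ) (Δ + 1), ha, hb, hab]
  refine Nat.le_of_lt_succ (lt_of_lt_of_le ?_ h₂)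
  convert h₁

/-! ### Encoding multisets as numbers -/

/-- A multiset of numbers, as the number whose digits in base `B` are the multiplicities. -/
def code (B : ℕ) (μ : Multiset ℕ) : ℕ := (μ.map fun t => B ^ t).sum

/-- Uniqueness of base `B` digits: reduce modulo `B` for the last digit, cancel it, and divide by
`B`. -/
theorem eq_of_sum_mul_pow_eq {B K : ℕ} {f g : ℕ → ℕ} (hf : ∀ t, f t < B) (hg : ∀ t, g t < B)
    (h : ∑ t ∈ range K, f t * B ^ t = ∑ t ∈ range K, g t * B ^ t) :
    ∀ t < K, f t = g t := by
  induction K generalizing f g with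
  | zero => intro t ht; omega
  | succ K ih =>
    rw [sum_range_succ', sum_range_succ'] at h
    have hs : ∀ f : ℕ → ℕ, ∑ t ∈ range K, f (t + 1) * B ^ (t + 1) =
        B * ∑ t ∈ range K, f (t + 1) * B ^ t := by
      intro f
      rw [mul_sum]
      exact sum_congr rfl fun t _ => by ring
    rw [hs, hs, pow_zero, mul_one, mul_one] at h
    have h0 : f 0 = g 0 := by
      have := congrArg (· % B) h
      simpa [Nat.mul_add_mod, Nat.mod_eq_of_lt (hf 0), Nat.mod_eq_of_lt (hg 0)] using this
    rw [h0] at h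
    have hB : 0 < B := (Nat.zero_le _).trans_lt (hf 0)
    have h' := Nat.eq_of_mul_eq_mul_left hB (Nat.add_right_cancel h)
    have := ih (f := fun t => f (t + 1)) (g := fun t => g (t + 1)) (fun t => hf _)
      (fun t => hg _) h'
    intro t ht
    rcases t with _ | t
    · exact h0
    · exact this t (by omega)

theorem code_eq_sum_range {B K : ℕ} {μ : Multiset ℕ} (h : ∀ t ∈ μ, t < K) :
    code B μ = ∑ t ∈ range K, μ.count t * B ^ t := by
  rw [code, sum_multiset_map_count]
  simp only [smul_eq_mul]
  refine sum_subset ?_ ?_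
  · intro t ht
    exact mem_range.2 (h t (Multiset.mem_toFinset.1 ht))
  · intro t _ ht
    rw [Multiset.mem_toFinset] at ht
    simp [Multiset.count_eq_zero_of_notMem ht]

/-- Multiplicities are at most the cardinality, hence below `B`, so they are the digits of the code.
-/
theorem code_inj {B K : ℕ} {μ ν : Multiset ℕ} (hμ : ∀ t ∈ μ, t < K) (hν : ∀ t ∈ ν, t < K)
    (hμB : Multiset.card μ < B) (hνB : Multiset.card ν < B) (h : code B μ = code B ν) :
    μ = ν := by
  rw [code_eq_sum_range hμ, code_eq_sum_range hν] at h
  have := eq_of_sum_mul_pow_eq (fun t => (Multiset.count_le_card t μ).trans_lt hμB)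
    (fun t => (Multiset.count_le_card t ν).trans_lt hνB) h
  ext t
  by_cases ht : t < K
  · exact this t ht
  · rw [Multiset.count_eq_zero_of_notMem fun h => ht (hμ t h),
      Multiset.count_eq_zero_of_notMem fun h => ht (hν t h)]

/-! ### Listing the multisets of bounded size -/

/-- The multisets obtained from `e` by adding between `1` and `χ - card e` copies of `p`. -/
def copies {α : Type*} (χ : ℕ) (p : α) (e : Multiset α) : List (Multiset α) :=
  (List.range (χ - Multiset.card e)).map fun k => e + Multiset.replicate (k + 1) p

/-- The multisets of size at most `χ` obtained from a member of `L` by adding copies of `p`. -/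
def expand {α : Type*} (χ : ℕ) (p : α) (L : List (Multiset α)) : List (Multiset α) :=
  L ++ L.flatMap (copies χ p)

/-- The members of `L` are the multisets of size at most `χ` of elements of `S`. -/
def ListsMultisets {α : Type*} (χ : ℕ) (S : Set α) (L : List (Multiset α)) : Prop :=
  ∀ μ, μ ∈ L ↔ Multiset.card μ ≤ χ ∧ ∀ p ∈ μ, p ∈ S

theorem listsMultisets_empty {α : Type*} (χ : ℕ) :
    ListsMultisets χ (∅ : Set α) [0] := by
  intro μ
  simp only [List.mem_singleton, Set.mem_empty_iff_false, imp_false]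
  constructor
  · rintro rfl
    simp
  · exact fun h => Multiset.eq_zero_of_forall_notMem h.2

theorem ListsMultisets.expand {α : Type*} {χ : ℕ} {S : Set α} {L : List (Multiset α)}
    (h : ListsMultisets χ S L) (p : α) :
    ListsMultisets χ (insert p S) (DefectiveColoring.expand χ p L) := by
  classical
  intro μ
  simp only [DefectiveColoring.expand, copies, List.mem_append, List.mem_flatMap, List.mem_map,
    List.mem_range, h μ]
  constructor
  · rintro (⟨h₁, h₂⟩ | ⟨e, he, k, hk, rfl⟩)
    · exact ⟨h₁, fun q hq => Or.inr (h₂ q hq)⟩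
    · rw [h e] at he
      refine ⟨by simp; omega, fun q hq => ?_⟩
      rcases Multiset.mem_add.1 hq with hq | hq
      · exact Or.inr (he.2 q hq)
      · exact Or.inl (Multiset.eq_of_mem_replicate hq)
  · rintro ⟨h₁, h₂⟩
    -- Separate the copies of `p` from the rest; the rest is already in the list for `S`.
    have hsplit : μ = μ.filter (fun q => ¬ q = p) + Multiset.replicate (μ.count p) p := by
      have he : μ.filter (fun q => q = p) = Multiset.replicate (μ.count p) p := by
        convert Multiset.filter_eq' μ p
      conv_lhs => rw [← Multiset.filter_add_not (fun q => q = p) μ, he, add_comm]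
    have hmem : ∀ q ∈ μ.filter (fun q => ¬ q = p), q ∈ S := by
      intro q hq
      rw [Multiset.mem_filter] at hq
      exact (h₂ q hq.1).resolve_left hq.2
    have hcard : Multiset.card μ =
        Multiset.card (μ.filter (fun q => ¬ q = p)) + μ.count p := by
      conv_lhs => rw [hsplit]
      simp
    rcases Nat.eq_zero_or_pos (μ.count p) with h0 | hpos
    · left
      rw [h0, Multiset.replicate_zero, add_zero] at hsplit
      rw [← hsplit] at hmem
      exact ⟨h₁, hmem⟩
    · right
      refine ⟨μ.filter (fun q => ¬ q = p), (h _).2 ⟨by omega, hmem⟩, μ.count p - 1, by omega, ?_⟩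
      rw [Nat.sub_add_cancel hpos, ← hsplit]

/-! ### Bounding the number of listed multisets -/

/-- Iterated over `P` elements, this yields the bound `(χ + 1) ^ P`. -/
theorem length_expand_le {α : Type*} (χ : ℕ) (p : α) (L : List (Multiset α)) :
    (expand χ p L).length ≤ (χ + 1) * L.length := by
  have : (L.flatMap (copies χ p)).length ≤ χ * L.length := by
    rw [List.length_flatMap]
    have := List.sum_le_card_nsmul (L.map fun e => (copies χ p e).length) χ (by
      simp only [List.mem_map]
      rintro _ ⟨e, -, rfl⟩
      simp [copies])
    simpa [mul_comm] using this
  rw [expand, List.length_append]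
  linarith

/-- A weighted count of the members of `L`. -/
def weight {α : Type*} (χ z : ℕ) (L : List (Multiset α)) : ℕ :=
  (L.map fun e => z ^ (χ - Multiset.card e)).sum

theorem sum_range_pow_le (z r : ℕ) : ∑ k ∈ range (r + 1), z ^ k ≤ (z + 1) ^ r := by
  induction r with
  | zero => simp
  | succ r ih =>
    rw [sum_range_succ, pow_succ (z + 1)]
    have : z ^ (r + 1) ≤ (z + 1) ^ r * z := by
      rw [pow_succ]
      exact Nat.mul_le_mul_right _ (Nat.pow_le_pow_left (by omega) _)
    linarith

/-- With `r` free places in `e`, the multiset `e` contributes `z ^ r` and its extensions by copies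
of `p` contribute `z ^ (r - 1), ..., z ^ 0`; the total is bounded by `sum_range_pow_le`. -/
theorem weight_copies {α : Type*} (χ z : ℕ) (p : α) (e : Multiset α) :
    z ^ (χ - Multiset.card e) + weight χ z (copies χ p e) ≤
      (z + 1) ^ (χ - Multiset.card e) := by
  refine le_trans (le_of_eq ?_) (sum_range_pow_le z (χ - Multiset.card e))
  rw [sum_range_succ, add_comm, weight, copies, List.map_map, ← sum_range_reflect,
    ← List.sum_toFinset _ List.nodup_range]
  congr 1
  rw [List.toFinset_range]
  refine sum_congr rfl fun k hk => ?_
  simp only [Function.comp, Multiset.card_add, Multiset.card_replicate]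
  congr 1
  omega

/-- A potential argument for the bound `(P + 1) ^ χ`. The list `[0]` has weight `(P + 1) ^ χ` at `z
= P + 1`, and an expansion followed by lowering `z` by one never increases the weight. After all `P`
elements `z = 1`, and the weight is the length. -/
theorem weight_expand_le {α : Type*} (χ z : ℕ) (p : α) (L : List (Multiset α)) :
    weight χ z (expand χ p L) ≤ weight χ (z + 1) L := by
  have : weight χ z (expand χ p L) = weight χ z L + (L.map fun e => weight χ z (copies χ p e)).sum := by
    unfold weight expand
    rw [List.map_append, List.sum_append]
    congr 1
    induction L with
    | nil => rfl
    | cons e L ih => simp [List.flatMap_cons, ih]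
  rw [this]
  unfold weight
  rw [← List.sum_map_add]
  exact List.sum_le_sum fun e _ => weight_copies χ z p e

theorem weight_mono {α : Type*} (χ z : ℕ) (L : List (Multiset α)) :
    weight χ z L ≤ weight χ (z + 1) L :=
  List.sum_le_sum fun _ _ => Nat.pow_le_pow_left (by omega) _

theorem length_le_weight {α : Type*} (χ z : ℕ) (hz : 1 ≤ z) (L : List (Multiset α)) :
    L.length ≤ weight χ z L := by
  have := List.card_nsmul_le_sum (L.map fun e => z ^ (χ - Multiset.card e)) 1 (by
    simp only [List.mem_map]
    rintro _ ⟨e, -, rfl⟩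
    exact Nat.one_le_pow _ _ hz)
  simpa [weight] using this

-- Shorthand for composing programs

infixr:30 " ;; " => Prog.seq

/-- The instruction sequence that copies register `y` to register `x`. -/
def copyReg (x y : ℕ) : Prog := .const x 0 ;; .add x x y

/-- A program without effect except on the scratch register `3`. -/
def skip : Prog := .const 3 0

theorem Ends.exec_seq {p q : Prog} {s : State} {T : ℕ} {Q : State → Prop}
    (hp : p.loopFree = true) (h : Ends q (p.exec s) T Q) : Ends (p ;; q) s (p.size + T) Q :=
  Ends.seq (Q₁ := fun s' => s' = p.exec s) (Ends.of_loopFree hp le_rfl rfl)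
    fun _ _ h₁ => h₁ ▸ h

theorem Ends.seq_exec {p q : Prog} {s : State} {T : ℕ} {Q : State → Prop}
    (hq : q.loopFree = true) (h : Ends p s T fun s' => Q (q.exec s')) :
    Ends (p ;; q) s (T + q.size) Q :=
  Ends.seq h fun _ _ h₁ => Ends.of_loopFree hq le_rfl h₁

/-! ### Listing multisets on the machine -/

/-- The numbers that stand for a multiset in the arrays `7`, `8`, `9`, `10`: three weighted sums
with offsets `a`, `b`, `c`, and the difference of `size` and the cardinality. -/
structure Layout (α : Type) where
  size : ℕ
  a : ℕ
  b : ℕ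
  c : ℕ
  wa : α → ℕ
  wb : α → ℕ
  wc : α → ℕ

/-- The machine holds the list `L` of multisets: its length in register `33`, its entries in the
arrays `7`, `8`, `9`, `10`. -/
structure Layout.Holds {α : Type} (l : Layout α) (L : List (Multiset α)) (s : State) : Prop where
  len : s.reg 33 = L.length
  entry : ∀ j μ, L[j]? = some μ → s.arr 7 j = l.a + (μ.map l.wa).sum ∧
    s.arr 8 j = l.b + (μ.map l.wb).sum ∧ s.arr 9 j = l.c + (μ.map l.wc).sum ∧
    s.arr 10 j = l.size - Multiset.card μ

theorem Layout.Holds.congr {α : Type} {l : Layout α} {L : List (Multiset α)} {s s' : State}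
    (h : l.Holds L s) (h33 : s'.reg 33 = s.reg 33) (h7 : s'.arr 7 = s.arr 7)
    (h8 : s'.arr 8 = s.arr 8) (h9 : s'.arr 9 = s.arr 9) (h10 : s'.arr 10 = s.arr 10) :
    l.Holds L s' :=
  ⟨h33.trans h.len, by rw [h7, h8, h9, h10]; exact h.entry⟩

theorem Layout.Holds.append {α : Type} {l : Layout α} {L : List (Multiset α)} {s s' : State}
    {μ : Multiset α} (h : l.Holds L s) (h33 : s'.reg 33 = L.length + 1)
    (h7 : s'.arr 7 = Function.update (s.arr 7) L.length (l.a + (μ.map l.wa).sum))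
    (h8 : s'.arr 8 = Function.update (s.arr 8) L.length (l.b + (μ.map l.wb).sum))
    (h9 : s'.arr 9 = Function.update (s.arr 9) L.length (l.c + (μ.map l.wc).sum))
    (h10 : s'.arr 10 = Function.update (s.arr 10) L.length (l.size - Multiset.card μ)) :
    l.Holds (L ++ [μ]) s' := by
  refine ⟨by simpa using h33, fun j ν hj => ?_⟩
  rw [h7, h8, h9, h10]
  rcases lt_trichotomy j L.length with hlt | rfl | hgt
  · rw [List.getElem?_append_left hlt] at hj
    simpa [Function.update_of_ne hlt.ne] using h.entry j ν hj
  · simp only [List.getElem?_concat_length, Option.some.injEq] at hj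
    subst hj
    simp
  · rw [List.getElem?_eq_none (by simp; omega)] at hj
    cases hj

/-- Append to the list the multiset in registers `50`, `51`, `52`, `53` after adding one element
with weights in registers `45`, `46`, `47`. -/
def copyStep : Prog :=
  .add 50 50 45 ;; .add 51 51 46 ;; .add 52 52 47 ;; .const 3 1 ;; .sub 53 53 3 ;;
  .store 7 33 50 ;; .store 8 33 51 ;; .store 9 33 52 ;; .store 10 33 53 ;; .add 33 33 3

/-- Append to the list all multisets obtained from entry number `49` by adding copies of one
element. -/
def copyProg : Prog :=
  (.load 50 7 49 ;; .load 51 8 49 ;; .load 52 9 49 ;; .load 53 10 49 ;; copyReg 54 53) ;;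
  forTo 55 54 copyStep

/-- Append to the list all multisets obtained from its entries by adding copies of one element. -/
def expandProg : Prog := copyReg 48 33 ;; forTo 49 48 copyProg

/-- Registers `50` to `53` carry the entry with `k` copies added so far. Adding one more copy is
three additions and a decrement of the free capacity, and the initial capacity is the number of
iterations. -/
theorem ends_copyProg {α : Type} {l : Layout α} {L : List (Multiset α)} {p : α} {s : State}
    {e : Multiset α} (h : l.Holds L s) (he : L[s.reg 49]? = some e) (h45 : s.reg 45 = l.wa p)
    (h46 : s.reg 46 = l.wb p) (h47 : s.reg 47 = l.wc p) :
    Ends copyProg s (l.size * 13 + 8) (l.Holds (L ++ copies l.size p e)) := by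
  obtain ⟨e7, e8, e9, e10⟩ := h.entry _ _ he
  refine (Ends.exec_seq rfl ?_).mono (T := 6 + ((l.size - Multiset.card e) * (10 + 3) + 2)) ?_
    (fun _ _ h => h)
  rotate_left
  · have : l.size - Multiset.card e ≤ l.size := Nat.sub_le _ _
    omega
  refine (Ends.forTo (T := 10) (N := l.size - Multiset.card e) (fun k s' =>
    l.Holds (L ++ (List.range k).map fun k => e + Multiset.replicate (k + 1) p) s' ∧
    s'.reg 50 = l.a + ((e + Multiset.replicate k p).map l.wa).sum ∧
    s'.reg 51 = l.b + ((e + Multiset.replicate k p).map l.wb).sum ∧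
    s'.reg 52 = l.c + ((e + Multiset.replicate k p).map l.wc).sum ∧
    s'.reg 53 = l.size - Multiset.card (e + Multiset.replicate k p)) ?_ rfl rfl (by norm_num)
    ?_ ?_).mono le_rfl (fun _ _ h => h.1)
  · simp [Prog.exec, copyReg, e10]
  · refine ⟨?_, ?_⟩
    · simp only [List.range_zero, List.map_nil, List.append_nil]
      exact h.congr (by simp [Prog.exec, copyReg]) rfl rfl rfl rfl
    · simp [Prog.exec, copyReg, e7, e8, e9, e10]
  · rintro k s₁ hk - hf ⟨hH, h50, h51, h52, h53⟩
    have f45 : s₁.reg 45 = l.wa p := by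
      rw [hf.reg 45 rfl, ← h45]; simp [Prog.exec, copyReg]
    have f46 : s₁.reg 46 = l.wb p := by
      rw [hf.reg 46 rfl, ← h46]; simp [Prog.exec, copyReg]
    have f47 : s₁.reg 47 = l.wc p := by
      rw [hf.reg 47 rfl, ← h47]; simp [Prog.exec, copyReg]
    refine Ends.of_loopFree rfl le_rfl ⟨?_, ?_, ?_, ?_, ?_⟩
    · rw [List.range_succ, List.map_append, ← List.append_assoc, List.map_singleton]
      refine hH.append ?_ ?_ ?_ ?_ ?_
      · simp [Prog.exec, copyStep, hH.len]
      all_goals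
        simp [Prog.exec, copyStep, hH.len, h50, h51, h52, h53, f45, f46, f47,
          add_assoc, add_comm, add_left_comm, Nat.sub_sub]
    all_goals
      simp [Prog.exec, copyStep, hH.len, h50, h51, h52, h53, f45, f46, f47,
        add_assoc, add_comm, add_left_comm, Nat.sub_sub]

/-- The old length is saved in register `48` before the loop, since the list grows while it is
traversed. New entries are appended at the end, so the entries still to be read are untouched. -/
theorem ends_expandProg {α : Type} {l : Layout α} {L : List (Multiset α)} {p : α} {s : State}
    (h : l.Holds L s) (h45 : s.reg 45 = l.wa p) (h46 : s.reg 46 = l.wb p)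
    (h47 : s.reg 47 = l.wc p) :
    Ends expandProg s (L.length * (l.size * 13 + 11) + 4) (l.Holds (expand l.size p L)) := by
  refine (Ends.exec_seq rfl ?_).mono (T := 2 + (L.length * ((l.size * 13 + 8) + 3) + 2)) (by ring_nf; rfl)
    (fun _ _ h => h)
  refine (Ends.forTo (T := l.size * 13 + 8) (N := L.length) (fun k s' =>
    l.Holds (L ++ (L.take k).flatMap (copies l.size p)) s') ?_ rfl rfl (by norm_num)
    ?_ ?_).mono le_rfl (fun _ _ h => by simpa [expand] using h)
  · simp [Prog.exec, copyReg, h.len]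
  · simp only [List.take_zero, List.flatMap_nil, List.append_nil]
    exact h.congr (by simp [Prog.exec, copyReg]) rfl rfl rfl rfl
  · intro k s₁ hk hi hf hH
    refine (ends_copyProg (e := L[k]) (p := p) hH ?_ ?_ ?_ ?_).mono le_rfl fun s₂ hf₂ hH₂ => ?_
    · rw [hi, List.getElem?_append_left hk, List.getElem?_eq_getElem hk]
    · rw [hf.reg 45 rfl, ← h45]; simp [Prog.exec, copyReg]
    · rw [hf.reg 46 rfl, ← h46]; simp [Prog.exec, copyReg]
    · rw [hf.reg 47 rfl, ← h47]; simp [Prog.exec, copyReg]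
    · rw [List.take_succ_eq_append_getElem hk, List.flatMap_append, ← List.append_assoc,
        List.flatMap_singleton]
      exact hH₂.congr (by simp) rfl rfl rfl rfl

/-! ### Listing the ways to merge two profiles -/

/-- From the sizes and degrees in registers `37`, `38` and `39`, `40`, compute the degrees of the
two sides of the union in registers `42` and `43` and its size in register `41`; register `32`
holds the kind of merge. -/
def combSides : Prog :=
  .add 41 37 39 ;; copyReg 42 38 ;; copyReg 43 40 ;; .const 3 0 ;;
  .ifLt 3 32 (.ifLt 3 37 (.ifLt 3 39 (.add 42 42 39 ;; .add 43 43 37) skip) skip) skip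

/-- Replace register `42` by the maximum of registers `42` and `43`, and truncate the size in
register `41`. -/
def combMax : Prog := .ifLt 42 43 (copyReg 42 43) skip ;; .ifLt 11 41 (copyReg 41 11) skip

theorem exec_combMax (s : State) :
    (combMax.exec s).reg 41 = min (s.reg 41) (s.reg 11) ∧
      (combMax.exec s).reg 42 = max (s.reg 42) (s.reg 43) := by
  by_cases h₁ : s.reg 42 < s.reg 43 <;> by_cases h₂ : s.reg 11 < s.reg 41 <;>
    simp [combMax, Prog.exec, copyReg, skip, h₁, h₂] <;> omega

theorem exec_combSides {Δ t u : ℕ} {s : State} (h11 : s.reg 11 = Δ + 1)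
    (h37 : s.reg 37 = t / (Δ + 2)) (h38 : s.reg 38 = t % (Δ + 2))
    (h39 : s.reg 39 = u / (Δ + 2)) (h40 : s.reg 40 = u % (Δ + 2)) :
    (combMax.exec (combSides.exec s)).reg 41 = combSize Δ t u ∧
      (combMax.exec (combSides.exec s)).reg 42 = combDeg Δ (0 < s.reg 32) t u := by
  rw [(exec_combMax _).1, (exec_combMax _).2]
  unfold combSize combDeg
  by_cases h₁ : 0 < s.reg 32 <;> by_cases h₂ : 0 < t / (Δ + 2) <;>
    by_cases h₃ : 0 < u / (Δ + 2) <;>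
    simp [combSides, Prog.exec, copyReg, skip, h11, h37, h38, h39, h40, h₁, h₂, h₃]

/-- Load the sizes and degrees of the types in registers `34` and `35`, and combine them. -/
def pairLoad : Prog :=
  .load 37 2 34 ;; .load 38 3 34 ;; .load 39 2 35 ;; .load 40 3 35 ;; combSides ;; combMax

/-- Expand the list by the pair of types in registers `34` and `35` unless their combination,
in registers `42` and `44`, exceeds the degree bound. -/
def pairExpand : Prog :=
  .ifLt 42 11 ((.add 44 44 42 ;; .load 45 1 34 ;; .load 46 1 35 ;; .load 47 1 44) ;; expandProg)
    skip

/-- Go on to the next pair of types. -/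
def pairNext : Prog :=
  .const 3 1 ;; .add 35 35 3 ;; .ifLt 35 7 skip (.const 35 0 ;; .add 34 34 3)

/-- Expand the list by the pair of types in registers `34` and `35`, and go on to the next. -/
def pairStep : Prog := pairLoad ;; mulProg 44 6 41 ;; pairExpand ;; pairNext

/-- Load the identifiers of the modules to be merged and start the list. -/
def listInit : Prog :=
  .load 29 4 27 ;; .load 30 4 28 ;; .const 33 0 ;; .store 7 33 29 ;; .store 8 33 30 ;;
  .add 31 0 22 ;; .store 9 33 31 ;; .store 10 33 1 ;; .const 33 1 ;; .const 34 0 ;; .const 35 0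

/-- List the multisets of at most `χ` pairs of types with admissible combination. -/
def listProg : Prog := listInit ;; forTo 36 8 pairStep

/-- The parameters of the algorithm and the tables of weights, sizes and degrees of types are in
place. -/
structure Ready (n χ Δ : ℕ) (s : State) : Prop where
  r0 : s.reg 0 = n
  r1 : s.reg 1 = χ
  r6 : s.reg 6 = Δ + 2
  r7 : s.reg 7 = (Δ + 2) * (Δ + 2)
  r8 : s.reg 8 = (Δ + 2) * (Δ + 2) * ((Δ + 2) * (Δ + 2))
  r11 : s.reg 11 = Δ + 1
  weight : ∀ t < (Δ + 2) * (Δ + 2), s.arr 1 t = 2 * n * (χ + 1) ^ t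
  size : ∀ t < (Δ + 2) * (Δ + 2), s.arr 2 t = t / (Δ + 2)
  deg : ∀ t < (Δ + 2) * (Δ + 2), s.arr 3 t = t % (Δ + 2)

theorem Ready.congr {n χ Δ : ℕ} {s s' : State} (h : Ready n χ Δ s)
    (hr : ∀ r ∈ [0, 1, 6, 7, 8, 11], s'.reg r = s.reg r)
    (ha : ∀ a ∈ [1, 2, 3], s'.arr a = s.arr a) : Ready n χ Δ s' := by
  simp only [List.forall_mem_cons, List.not_mem_nil, false_imp_iff, implies_true, and_true] at hr ha
  obtain ⟨h0, h1, h6, h7, h8, h11⟩ := hr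
  obtain ⟨a1, a2, a3⟩ := ha
  exact ⟨h0.trans h.r0, h1.trans h.r1, h6.trans h.r6, h7.trans h.r7, h8.trans h.r8,
    h11.trans h.r11, by rw [a1]; exact h.weight, by rw [a2]; exact h.size,
    by rw [a3]; exact h.deg⟩

/-- The pairs of types with admissible combination. -/
def goodPairs (Δ : ℕ) (op : Prop) : Set (ℕ × ℕ) :=
  {p | p.1 < (Δ + 2) * (Δ + 2) ∧ p.2 < (Δ + 2) * (Δ + 2) ∧ combDeg Δ op p.1 p.2 ≤ Δ}

/-- The admissible pairs of types among the first `q` pairs in lexicographic order. -/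
def goodPairsBelow (Δ : ℕ) (op : Prop) (q : ℕ) : Set (ℕ × ℕ) :=
  {p | p ∈ goodPairs Δ op ∧ p.1 * ((Δ + 2) * (Δ + 2)) + p.2 < q}

/-- The weights of pairs of types in the merge of the modules `a` and `b` into the module `c`. -/
noncomputable def mergeLayout (n χ Δ : ℕ) (op : Prop) (a b c : ℕ) : Layout (ℕ × ℕ) where
  size := χ
  a := a
  b := b
  c := c
  wa p := 2 * n * (χ + 1) ^ p.1
  wb p := 2 * n * (χ + 1) ^ p.2
  wc p := 2 * n * (χ + 1) ^ combType Δ op p.1 p.2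

/-- A bound for the number of multisets of size at most `χ` on `P` elements. -/
def listBound (χ P : ℕ) : ℕ := min ((χ + 1) ^ P) ((P + 1) ^ χ)

theorem combType_lt {Δ t u : ℕ} {op : Prop} (h : combDeg Δ op t u ≤ Δ) :
    combType Δ op t u < (Δ + 2) * (Δ + 2) := by
  have h₁ : combSize Δ t u ≤ Δ + 1 := min_le_right _ _
  have h₂ : combSize Δ t u * (Δ + 2) ≤ (Δ + 1) * (Δ + 2) := Nat.mul_le_mul_right _ h₁
  have h₃ : (Δ + 2) * (Δ + 2) = (Δ + 1) * (Δ + 2) + (Δ + 2) := by ring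
  rw [combType]
  omega

/-- In lexicographic order, pair number `q` is given by the quotient and the remainder of `q` by the
number of types. -/
theorem goodPairsBelow_succ (Δ : ℕ) (op : Prop) {q : ℕ}
    (hq : q < (Δ + 2) * (Δ + 2) * ((Δ + 2) * (Δ + 2))) :
    goodPairsBelow Δ op (q + 1) =
      if combDeg Δ op (q / ((Δ + 2) * (Δ + 2))) (q % ((Δ + 2) * (Δ + 2))) ≤ Δ
      then insert (q / ((Δ + 2) * (Δ + 2)), q % ((Δ + 2) * (Δ + 2))) (goodPairsBelow Δ op q)
      else goodPairsBelow Δ op q := by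
  unfold goodPairsBelow goodPairs
  have hm : 0 < (Δ + 2) * (Δ + 2) := by positivity
  generalize (Δ + 2) * (Δ + 2) = m at *
  have hdiv : q / m < m := (Nat.div_lt_iff_lt_mul hm).2 hq
  have hmod := Nat.mod_lt q hm
  have hqm := Nat.div_add_mod' q m
  have huniq : ∀ a b : ℕ, b < m → a * m + b = q → a = q / m ∧ b = q % m := by
    rintro a b hb rfl
    rw [mul_comm a m]
    rw [Nat.mul_add_div hm, Nat.div_eq_of_lt hb, Nat.mul_add_mod, Nat.mod_eq_of_lt hb]
    simp
  ext ⟨a, b⟩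
  split_ifs with h
  · simp only [Set.mem_ofPred_eq, Set.mem_insert_iff, Prod.mk.injEq]
    constructor
    · rintro ⟨⟨ha, hb, hd⟩, hlt⟩
      by_cases he : a * m + b = q
      · exact Or.inl (huniq a b hb he)
      · exact Or.inr ⟨⟨ha, hb, hd⟩, by omega⟩
    · rintro (⟨rfl, rfl⟩ | ⟨h₁, h₂⟩)
      · exact ⟨⟨hdiv, hmod, h⟩, by omega⟩
      · exact ⟨h₁, by omega⟩
  · simp only [Set.mem_ofPred_eq]
    constructor
    · rintro ⟨⟨ha, hb, hd⟩, hlt⟩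
      refine ⟨⟨ha, hb, hd⟩, ?_⟩
      have : a * m + b ≠ q := by
        intro he
        obtain ⟨rfl, rfl⟩ := huniq a b hb he
        exact h hd
      omega
    · rintro ⟨h₁, h₂⟩
      exact ⟨h₁, by omega⟩

/-- The machine holds a list of the multisets of at most `χ` pairs among the first `q`. -/
def ListedBelow (n χ Δ : ℕ) (op : Prop) (a b c q : ℕ) (s : State) : Prop :=
  ∃ L, (mergeLayout n χ Δ op a b c).Holds L s ∧ ListsMultisets χ (goodPairsBelow Δ op q) L ∧
    L.length ≤ (χ + 1) ^ q ∧
    weight χ ((Δ + 2) * (Δ + 2) * ((Δ + 2) * (Δ + 2)) - q + 1) L ≤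
      ((Δ + 2) * (Δ + 2) * ((Δ + 2) * (Δ + 2)) + 1) ^ χ

theorem length_le_listBound {α : Type*} {χ P q : ℕ} {L : List (Multiset α)} (hq : q ≤ P)
    (h₁ : L.length ≤ (χ + 1) ^ q) (h₂ : weight χ (P - q + 1) L ≤ (P + 1) ^ χ) :
    L.length ≤ listBound χ P :=
  le_min (h₁.trans (Nat.pow_le_pow_right (by omega) hq))
    ((length_le_weight χ (P - q + 1) (by omega) L).trans h₂)

/-- Registers `34` and `35` form a two-digit counter for `q`. An inadmissible pair leaves the list
alone; both length bounds persist because they are monotone in the right directions. -/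
theorem ends_pairStep {n χ Δ a b c q : ℕ} {op : Prop} {s : State} (hs : Ready n χ Δ s)
    (hop : 0 < s.reg 32 ↔ op) (hq : q < (Δ + 2) * (Δ + 2) * ((Δ + 2) * (Δ + 2)))
    (h34 : s.reg 34 = q / ((Δ + 2) * (Δ + 2))) (h35 : s.reg 35 = q % ((Δ + 2) * (Δ + 2)))
    (hL : ListedBelow n χ Δ op a b c q s) :
    Ends pairStep s
      (listBound χ ((Δ + 2) * (Δ + 2) * ((Δ + 2) * (Δ + 2))) * (χ * 13 + 11) + Δ * 4 + 60)
      fun s' => ListedBelow n χ Δ op a b c (q + 1) s' ∧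
        s'.reg 34 = (q + 1) / ((Δ + 2) * (Δ + 2)) ∧
        s'.reg 35 = (q + 1) % ((Δ + 2) * (Δ + 2)) := by
  set m := (Δ + 2) * (Δ + 2) with hm
  have hmpos : 0 < m := by positivity
  obtain rfl : op = (0 < s.reg 32) := propext hop.symm
  obtain ⟨L, hH, hlist, hlen, hw⟩ := hL
  have h34m : s.reg 34 < m := by rw [h34]; exact (Nat.div_lt_iff_lt_mul hmpos).2 hq
  have h35m : s.reg 35 < m := by rw [h35]; exact Nat.mod_lt _ hmpos
  have hlenM := length_le_listBound hq.le hlen hw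
  set s₁ := pairLoad.exec s with hs₁
  have hf₁ : Frame pairLoad s s₁ := by
    obtain ⟨t, -, h⟩ := pairLoad.exists_runs_exec rfl s
    exact h.frame
  have hcomb : s₁.reg 41 = combSize Δ (s.reg 34) (s.reg 35) ∧
      s₁.reg 42 = combDeg Δ (0 < s.reg 32) (s.reg 34) (s.reg 35) := by
    have := exec_combSides (Δ := Δ) (t := s.reg 34) (u := s.reg 35)
      (s := (Prog.load 37 2 34 ;; Prog.load 38 3 34 ;; Prog.load 39 2 35 ;;
        Prog.load 40 3 35).exec s) (by simp [Prog.exec, hs.r11])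
      (by simp [Prog.exec, hs.size _ h34m]) (by simp [Prog.exec, hs.deg _ h34m])
      (by simp [Prog.exec, hs.size _ h35m]) (by simp [Prog.exec, hs.deg _ h35m])
    simpa [hs₁, pairLoad, Prog.exec] using this
  have h41 : s₁.reg 41 ≤ Δ + 1 := by rw [hcomb.1]; exact min_le_right _ _
  refine (Ends.exec_seq (T := ((Δ + 1) * 4 + 3) +
    ((4 + (L.length * (χ * 13 + 11) + 4) + 1) + pairNext.size)) rfl ?_).mono ?_ (fun _ _ h => h)
  rotate_left
  · have e₁ : pairLoad.size + pairNext.size ≤ 40 := by decide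
    have e₂ := Nat.mul_le_mul_right (χ * 13 + 11) hlenM
    omega
  refine Ends.seq ((Ends.mul (z := 44) (x := 6) (y := 41) rfl rfl (by norm_num)).mono
    (Nat.add_le_add_right (Nat.mul_le_mul_right 4 h41) 3) fun _ _ h => h) fun s₂ hf₂ h44 => ?_
  have hnext : ∀ s₃ : State, Frame pairExpand s₂ s₃ →
      (pairNext.exec s₃).reg 34 = (q + 1) / m ∧ (pairNext.exec s₃).reg 35 = (q + 1) % m := by
    intro s₃ hf₃
    have g34 : s₃.reg 34 = q / m := by
      rw [hf₃.reg 34 rfl, hf₂.reg 34 rfl, hf₁.reg 34 rfl, h34]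
    have g35 : s₃.reg 35 = q % m := by
      rw [hf₃.reg 35 rfl, hf₂.reg 35 rfl, hf₁.reg 35 rfl, h35]
    have g7 : s₃.reg 7 = m := by
      rw [hf₃.reg 7 rfl, hf₂.reg 7 rfl, hf₁.reg 7 rfl, hs.r7]
    rw [Nat.add_div hmpos, Nat.add_mod]
    have hm4 : 4 ≤ m := by rw [hm]; nlinarith
    have h1 : 1 / m = 0 := Nat.div_eq_of_lt (by omega)
    have h1' : 1 % m = 1 := Nat.mod_eq_of_lt (by omega)
    rw [h1, h1']
    have hmod := Nat.mod_lt q hmpos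
    by_cases hc : q % m + 1 < m
    · simp [pairNext, skip, Prog.exec, g34, g35, g7, hc, Nat.mod_eq_of_lt hc]
    · have hc' : q % m + 1 = m := by omega
      simp [pairNext, Prog.exec, g34, g35, g7, hc']
  refine Ends.seq_exec rfl ?_
  have hkeep : ∀ s₃ : State, ∀ L', (mergeLayout n χ Δ (0 < s.reg 32) a b c).Holds L' s₃ →
      (mergeLayout n χ Δ (0 < s.reg 32) a b c).Holds L' (pairNext.exec s₃) := by
    intro s₃ L' h
    obtain ⟨t, -, hr⟩ := pairNext.exists_runs_exec rfl s₃
    exact h.congr (hr.frame.reg _ rfl) (hr.frame.arr _ rfl) (hr.frame.arr _ rfl)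
      (hr.frame.arr _ rfl) (hr.frame.arr _ rfl)
  have hH₂ : (mergeLayout n χ Δ (0 < s.reg 32) a b c).Holds L s₂ :=
    hH.congr (by rw [hf₂.reg 33 rfl, hf₁.reg 33 rfl]) (by rw [hf₂.arr 7 rfl, hf₁.arr 7 rfl])
      (by rw [hf₂.arr 8 rfl, hf₁.arr 8 rfl]) (by rw [hf₂.arr 9 rfl, hf₁.arr 9 rfl])
      (by rw [hf₂.arr 10 rfl, hf₁.arr 10 rfl])
  have g42 : s₂.reg 42 = combDeg Δ (0 < s.reg 32) (s.reg 34) (s.reg 35) := by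
    rw [hf₂.reg 42 rfl, hcomb.2]
  have g11 : s₂.reg 11 = Δ + 1 := by rw [hf₂.reg 11 rfl, hf₁.reg 11 rfl, hs.r11]
  have g34 : s₂.reg 34 = s.reg 34 := by rw [hf₂.reg 34 rfl, hf₁.reg 34 rfl]
  have g35 : s₂.reg 35 = s.reg 35 := by rw [hf₂.reg 35 rfl, hf₁.reg 35 rfl]
  have garr : s₂.arr 1 = s.arr 1 := by rw [hf₂.arr 1 rfl, hf₁.arr 1 rfl]
  -- The weight parameter `P - q + 1` drops by exactly one per pair, as `weight_expand_le` and
  -- `weight_mono` require.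
  have hsub : m * m - q + 1 = (m * m - (q + 1) + 1) + 1 := by omega
  refine (Ends.ifLt (T := 4 + (L.length * (χ * 13 + 11) + 4)) (fun hlt => ?_)
    (fun hlt => ?_) : Ends pairExpand _ _ _).mono
      (Q := fun s₃ => ListedBelow n χ Δ (0 < s.reg 32) a b c (q + 1) (pairNext.exec s₃)) le_rfl
      fun s₃ hf h => ⟨h, hnext s₃ hf⟩
  · have hgood : combDeg Δ (0 < s.reg 32) (s.reg 34) (s.reg 35) ≤ Δ := by omega
    have h44' : s₂.reg 44 + s₂.reg 42 = combType Δ (0 < s.reg 32) (s.reg 34) (s.reg 35) := by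
      rw [h44, g42, combType, hcomb.1, hf₁.reg 6 rfl, hs.r6, mul_comm]
    refine Ends.exec_seq rfl ?_
    refine (ends_expandProg (L := L) (p := (s.reg 34, s.reg 35))
      (l := mergeLayout n χ Δ (0 < s.reg 32) a b c) ?_ ?_ ?_ ?_).mono le_rfl fun s₃ _ h => ?_
    · exact hH₂.congr (by simp [Prog.exec]) rfl rfl rfl rfl
    · simp [Prog.exec, g34, garr, mergeLayout, hs.weight _ h34m]
    · simp [Prog.exec, g35, garr, mergeLayout, hs.weight _ h35m]
    · simp [Prog.exec, h44', garr, mergeLayout, hs.weight _ (combType_lt hgood)]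
    · refine ⟨_, hkeep _ _ h, ?_, ?_, ?_⟩
      · rw [goodPairsBelow_succ _ _ hq, ← hm, ← h34, ← h35, if_pos hgood]
        exact hlist.expand _
      · rw [pow_succ, mul_comm]
        exact (length_expand_le _ _ _).trans (Nat.mul_le_mul_left _ hlen)
      · rw [hsub] at hw
        exact (weight_expand_le _ _ _ _).trans hw
  · have hgood : ¬ combDeg Δ (0 < s.reg 32) (s.reg 34) (s.reg 35) ≤ Δ := by omega
    refine Ends.of_loopFree rfl (by simp [skip, Prog.size]; omega) ⟨L, hkeep _ _ ?_, ?_, ?_, ?_⟩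
    · exact hH₂.congr (by simp [Prog.exec, skip]) rfl rfl rfl rfl
    · rw [goodPairsBelow_succ _ _ hq, ← hm, ← h34, ← h35, if_neg hgood]
      exact hlist
    · exact hlen.trans (Nat.pow_le_pow_right (by omega) (by omega))
    · rw [hsub] at hw
      exact (weight_mono _ _ _).trans hw

/-- The machine holds a list of the multisets of at most `χ` admissible pairs of types. -/
def Listed (n χ Δ : ℕ) (op : Prop) (a b c : ℕ) (s : State) : Prop :=
  ∃ L, (mergeLayout n χ Δ op a b c).Holds L s ∧ ListsMultisets χ (goodPairs Δ op) L ∧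
    L.length ≤ listBound χ ((Δ + 2) * (Δ + 2) * ((Δ + 2) * (Δ + 2)))

theorem ends_listProg {n χ Δ : ℕ} {s : State} (hs : Ready n χ Δ s) :
    Ends listProg s
      ((Δ + 2) * (Δ + 2) * ((Δ + 2) * (Δ + 2)) *
        (listBound χ ((Δ + 2) * (Δ + 2) * ((Δ + 2) * (Δ + 2))) * (χ * 13 + 11) + Δ * 4 + 63) + 13)
      (Listed n χ Δ (0 < s.reg 32) (s.arr 4 (s.reg 27)) (s.arr 4 (s.reg 28)) (n + s.reg 22)) := by
  refine (Ends.exec_seq rfl ?_).mono (le_of_eq (?_ : listInit.size + ((Δ + 2) * (Δ + 2) *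
    ((Δ + 2) * (Δ + 2)) * (listBound χ ((Δ + 2) * (Δ + 2) * ((Δ + 2) * (Δ + 2))) *
      (χ * 13 + 11) + Δ * 4 + 60 + 3) + 2) = _)) (fun _ _ h => h)
  swap
  · have : listInit.size = 11 := rfl
    rw [this]
    ring
  set s₁ := listInit.exec s with hs₁
  have hf₁ : Frame listInit s s₁ := by
    obtain ⟨t, -, h⟩ := listInit.exists_runs_exec rfl s
    exact h.frame
  refine (Ends.forTo (N := (Δ + 2) * (Δ + 2) * ((Δ + 2) * (Δ + 2))) (fun q s' =>
    ListedBelow n χ Δ (0 < s.reg 32) (s.arr 4 (s.reg 27)) (s.arr 4 (s.reg 28)) (n + s.reg 22) q s'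
      ∧ s'.reg 34 = q / ((Δ + 2) * (Δ + 2)) ∧ s'.reg 35 = q % ((Δ + 2) * (Δ + 2))) ?_ rfl rfl
    (by norm_num) ?_ ?_).mono le_rfl ?_
  · rw [hf₁.reg 8 rfl, hs.r8]
  -- The enumeration starts with the empty multiset only.
  · refine ⟨⟨[0], ⟨?_, ?_⟩, ?_, ?_, ?_⟩, ?_, ?_⟩
    · simp [hs₁, listInit, Prog.exec]
    · intro j μ hj
      rcases j with _ | j
      · simp only [List.getElem?_cons_zero, Option.some.injEq] at hj
        subst hj
        simp [hs₁, listInit, Prog.exec, mergeLayout, hs.r0, hs.r1]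
      · simp at hj
    · have : goodPairsBelow Δ (0 < s.reg 32) 0 = ∅ := by
        ext p
        simp [goodPairsBelow]
      rw [this]
      exact listsMultisets_empty χ
    · simp
    · simp [weight]
    · simp [hs₁, listInit, Prog.exec]
    · simp [hs₁, listInit, Prog.exec]
  · rintro q s₂ hq - hf₂ ⟨hl, h34, h35⟩
    have hr : Ready n χ Δ s₂ := by
      refine hs.congr (fun r hr => ?_) (fun a ha => ?_)
      · simp only [List.mem_cons, List.not_mem_nil, or_false] at hr
        rcases hr with rfl | rfl | rfl | rfl | rfl | rfl <;>
          rw [hf₂.reg _ rfl, hf₁.reg _ rfl]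
      · simp only [List.mem_cons, List.not_mem_nil, or_false] at ha
        rcases ha with rfl | rfl | rfl <;> rw [hf₂.arr _ rfl, hf₁.arr _ rfl]
    refine (ends_pairStep hr ?_ hq h34 h35 hl).mono le_rfl fun s₃ _ ⟨h₁, h₂, h₃⟩ => ⟨?_, ?_, ?_⟩
    · rw [hf₂.reg 32 rfl, hf₁.reg 32 rfl]
    · obtain ⟨L, hH, hL⟩ := h₁
      exact ⟨L, hH.congr (by simp) rfl rfl rfl rfl, hL⟩
    · simpa using h₂
    · simpa using h₃
  · rintro s' - ⟨⟨L, hH, hL, hlen, hw⟩, -, -⟩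
    refine ⟨L, hH, ?_, length_le_listBound le_rfl hlen hw⟩
    convert hL using 1
    -- All pairs of types have index below the square of the number of types, so the restriction to
    -- the first `q` pairs has become void.
    ext ⟨a, b⟩
    simp only [goodPairsBelow, goodPairs, Set.mem_ofPred_eq, iff_self_and]
    generalize (Δ + 2) * (Δ + 2) = m
    rintro ⟨ha, hb, -⟩
    calc a * m + b < (a + 1) * m := by rw [add_mul]; omega
      _ ≤ m * m := Nat.mul_le_mul_right _ ha

/-! ### Updating the tables -/

/-- If entry number `56` of the list has full size and its first two numbers are marked in
array `6`, then mark its third number and set register `13` to `1`. -/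
def applyStep : Prog :=
  .load 57 10 56 ;; .load 58 7 56 ;; .load 58 6 58 ;; .load 59 8 56 ;; .load 59 6 59 ;;
  .load 60 9 56 ;; .const 3 1 ;;
  .ifLt 57 3 (.const 3 0 ;; .ifLt 3 58 (.ifLt 3 59 (.const 13 1 ;; .store 6 60 13) skip) skip) skip

/-- Mark the third number of every entry of full size whose first two numbers are marked;
register `13` tells whether there is any. -/
def applyProg : Prog := .const 13 0 ;; forTo 56 33 applyStep

/-- The multiset `μ` has full size and its first two numbers are marked in `T`. -/
def Layout.Hit {α : Type} (l : Layout α) (T : ℕ → ℕ) (μ : Multiset α) : Prop :=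
  l.size - Multiset.card μ = 0 ∧ 0 < T (l.a + (μ.map l.wa).sum) ∧ 0 < T (l.b + (μ.map l.wb).sum)

open Classical in
-- By `ha` and `hb` the addresses that are read are disjoint from those that are written. Marks made
-- during the loop thus never influence later tests, and the outcome is expressed by the original
-- table.
theorem ends_applyProg {α : Type} {l : Layout α} {L : List (Multiset α)} {s : State}
    (h : l.Holds L s)
    (ha : ∀ μ ∈ L, ∀ ν ∈ L, l.a + (μ.map l.wa).sum ≠ l.c + (ν.map l.wc).sum)
    (hb : ∀ μ ∈ L, ∀ ν ∈ L, l.b + (μ.map l.wb).sum ≠ l.c + (ν.map l.wc).sum) :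
    Ends applyProg s (L.length * 20 + 3) fun s' =>
      (∀ x, s'.arr 6 x = if ∃ μ ∈ L, l.Hit (s.arr 6) μ ∧ l.c + (μ.map l.wc).sum = x then 1
        else s.arr 6 x) ∧
      s'.reg 13 = if ∃ μ ∈ L, l.Hit (s.arr 6) μ then 1 else 0 := by
  refine (Ends.exec_seq rfl ?_).mono (T := 1 + (L.length * (17 + 3) + 2)) (by omega)
    (fun _ _ h => h)
  refine (Ends.forTo (N := L.length) (fun k s' =>
    (∀ x, s'.arr 6 x = if ∃ μ ∈ L.take k, l.Hit (s.arr 6) μ ∧ l.c + (μ.map l.wc).sum = x then 1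
        else s.arr 6 x) ∧
      s'.reg 13 = if ∃ μ ∈ L.take k, l.Hit (s.arr 6) μ then 1 else 0) ?_ rfl rfl (by norm_num)
    ?_ ?_).mono le_rfl (fun _ _ h => by simpa using h)
  · simp [Prog.exec, h.len]
  · simp [Prog.exec]
  · rintro k s₁ hk hi hf ⟨hT, hans⟩
    obtain ⟨e7, e8, e9, e10⟩ := h.entry k L[k] (List.getElem?_eq_getElem hk)
    have f7 : s₁.arr 7 k = l.a + (L[k].map l.wa).sum := by rw [hf.arr 7 rfl]; exact e7
    have f8 : s₁.arr 8 k = l.b + (L[k].map l.wb).sum := by rw [hf.arr 8 rfl]; exact e8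
    have f9 : s₁.arr 9 k = l.c + (L[k].map l.wc).sum := by rw [hf.arr 9 rfl]; exact e9
    have f10 : s₁.arr 10 k = l.size - Multiset.card L[k] := by rw [hf.arr 10 rfl]; exact e10
    have hmem : L[k] ∈ L := List.getElem_mem hk
    have ta : s₁.arr 6 (l.a + (L[k].map l.wa).sum) = s.arr 6 (l.a + (L[k].map l.wa).sum) := by
      rw [hT, if_neg]
      rintro ⟨μ, hμ, -, he⟩
      exact ha _ hmem _ (List.mem_of_mem_take hμ) he.symm
    have tb : s₁.arr 6 (l.b + (L[k].map l.wb).sum) = s.arr 6 (l.b + (L[k].map l.wb).sum) := by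
      rw [hT, if_neg]
      rintro ⟨μ, hμ, -, he⟩
      exact hb _ hmem _ (List.mem_of_mem_take hμ) he.symm
    refine Ends.of_loopFree rfl (by decide) ?_
    rw [List.take_succ_eq_append_getElem hk]
    have hex : ∀ p : Multiset α → Prop, (∃ μ ∈ L.take k ++ [L[k]], p μ) ↔
        (∃ μ ∈ L.take k, p μ) ∨ p L[k] := by
      intro p
      simp only [List.mem_append, List.mem_singleton, or_and_right, exists_or, exists_eq_left]
    simp only [hex]
    by_cases hit : l.Hit (s.arr 6) L[k]
    · have hx : ∀ x, ((applyStep.exec s₁).arr 6) x = if x = l.c + (L[k].map l.wc).sum then 1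
          else s₁.arr 6 x := by
        intro x
        obtain ⟨h₁, h₂, h₃⟩ := hit
        simp [applyStep, Prog.exec, hi, f7, f8, f9, f10, ta, tb, h₁, h₂, h₃,
          Function.update_apply]
      have h13 : (applyStep.exec s₁).reg 13 = 1 := by
        obtain ⟨h₁, h₂, h₃⟩ := hit
        simp [applyStep, Prog.exec, hi, f7, f8, f9, f10, ta, tb, h₁, h₂, h₃]
      refine ⟨fun x => ?_, by simp [h13, hit]⟩
      simp only [State.setReg_arr, hx, hT, hit, true_and]
      by_cases hc : x = l.c + (L[k].map l.wc).sum
      · simp [hc]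
      · simp [hc, Ne.symm hc]
    · have h0 : (applyStep.exec s₁).arr 6 = s₁.arr 6 ∧
          (applyStep.exec s₁).reg 13 = s₁.reg 13 := by
        unfold Layout.Hit at hit
        by_cases h₁ : l.size - Multiset.card L[k] = 0
        swap
        · simp [applyStep, Prog.exec, skip, hi, f10, h₁]
        by_cases h₂ : 0 < s.arr 6 (l.a + (L[k].map l.wa).sum)
        swap
        · simp [applyStep, Prog.exec, skip, hi, f7, f10, ta, h₁, h₂]
        by_cases h₃ : 0 < s.arr 6 (l.b + (L[k].map l.wb).sum)
        · exact absurd ⟨h₁, h₂, h₃⟩ hit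
        · simp [applyStep, Prog.exec, skip, hi, f7, f8, f9, f10, ta, tb, h₁, h₂, h₃]
      refine ⟨fun x => ?_, ?_⟩
      · simp only [State.setReg_arr, h0.1, hT, hit, false_and, or_false]
      · simp [h0.2, hans, hit]

/-! ### Finding twins -/

/-- Run `p` if registers `x` and `y` differ. -/
def ifNe (x y : ℕ) (p : Prog) : Prog := .ifLt x y p (.ifLt y x p skip)

theorem exec_ifNe (x y : ℕ) (p : Prog) (s : State) :
    (ifNe x y p).exec s = if s.reg x = s.reg y then skip.exec s else p.exec s := by
  unfold ifNe
  simp only [Prog.exec]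
  split_ifs <;> first | rfl | omega

/-- Set register `25` to `0` if the vertex in register `26` distinguishes those in registers `23`
and `24`. -/
def checkStep : Prog :=
  .load 29 11 23 ;; .add 29 29 26 ;; .load 29 0 29 ;;
  .load 30 11 24 ;; .add 30 30 26 ;; .load 30 0 30 ;; .load 31 5 26 ;; .const 3 1 ;;
  .ifLt 31 3 (ifNe 26 23 (ifNe 26 24 (ifNe 29 30 (.const 25 0)))) skip

/-- Copy registers `23` and `24` to registers `27` and `28` if they hold two vertices in increasing
order that are not deleted, and register `25` is not `0`. -/
def selectStep : Prog :=
  .load 31 5 23 ;; .load 29 5 24 ;; .add 31 31 29 ;; .const 3 1 ;;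
  .ifLt 31 3 (.ifLt 23 24 (.const 3 0 ;; .ifLt 3 25 (copyReg 27 23 ;; copyReg 28 24) skip) skip)
    skip

/-- Find twins among the vertices that are not deleted. -/
def findProg : Prog :=
  forTo 23 0 (forTo 24 0 (.const 25 1 ;; (forTo 26 0 checkStep ;; selectStep)))

/-- The vertex `z` does not distinguish `x` and `y` among the vertices not marked in `dead`. -/
def Agree (adj row dead : ℕ → ℕ) (x y z : ℕ) : Prop :=
  dead z = 0 → z ≠ x → z ≠ y → adj (row x + z) = adj (row y + z)

/-- The vertices `x` and `y` are twins among the vertices not marked in `dead`. -/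
structure AreTwins (adj row dead : ℕ → ℕ) (n x y : ℕ) : Prop where
  lt : x < y
  lt_n : y < n
  left : dead x = 0
  right : dead y = 0
  agree : ∀ z < n, Agree adj row dead x y z

open Classical in
theorem exec_checkStep (s : State) :
    (checkStep.exec s).reg 25 =
      if Agree (s.arr 0) (s.arr 11) (s.arr 5) (s.reg 23) (s.reg 24) (s.reg 26) then s.reg 25
      else 0 := by
  unfold Agree
  by_cases h₁ : s.arr 5 (s.reg 26) = 0
  swap
  · simp [checkStep, Prog.exec, skip, h₁]
  by_cases h₂ : s.reg 26 = s.reg 23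
  · simp [checkStep, Prog.exec, exec_ifNe, skip, h₂]
  by_cases h₃ : s.reg 26 = s.reg 24
  · simp [checkStep, Prog.exec, exec_ifNe, skip, h₃]
  by_cases h₄ : s.arr 0 (s.arr 11 (s.reg 23) + s.reg 26) = s.arr 0 (s.arr 11 (s.reg 24) + s.reg 26)
  · simp [checkStep, Prog.exec, exec_ifNe, skip, h₁, h₂, h₃, h₄]
  · simp [checkStep, Prog.exec, exec_ifNe, h₁, h₂, h₃, h₄]

open Classical in
theorem exec_selectStep (s : State) :
    (selectStep.exec s).reg 27 = (if s.arr 5 (s.reg 23) = 0 ∧ s.arr 5 (s.reg 24) = 0 ∧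
      s.reg 23 < s.reg 24 ∧ 0 < s.reg 25 then s.reg 23 else s.reg 27) ∧
    (selectStep.exec s).reg 28 = (if s.arr 5 (s.reg 23) = 0 ∧ s.arr 5 (s.reg 24) = 0 ∧
      s.reg 23 < s.reg 24 ∧ 0 < s.reg 25 then s.reg 24 else s.reg 28) := by
  by_cases h₁ : s.arr 5 (s.reg 23) = 0 <;> by_cases h₂ : s.arr 5 (s.reg 24) = 0 <;>
    by_cases h₃ : s.reg 23 < s.reg 24 <;> by_cases h₄ : 0 < s.reg 25 <;>
    simp [selectStep, Prog.exec, copyReg, skip, h₁, h₂, h₃, h₄]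

/-- All ordered pairs are tried and every success overwrites registers `27` and `28`. The invariants
are implications: once the pairs tried so far include twins, the registers hold twins. -/
theorem ends_findProg {n : ℕ} {s : State} (hn : s.reg 0 = n)
    (hex : ∃ x y, AreTwins (s.arr 0) (s.arr 11) (s.arr 5) n x y) :
    Ends findProg s (n * (n * (n * 50 + 60) + 60) + 2) fun s' =>
      AreTwins (s.arr 0) (s.arr 11) (s.arr 5) n (s'.reg 27) (s'.reg 28) := by
  classical
  refine (Ends.forTo (N := n) (T := n * (n * (40 + 3) + 2 + 20 + 3) + 2) (fun kx s' =>
    (∃ x y, AreTwins (s.arr 0) (s.arr 11) (s.arr 5) n x y ∧ x < kx) →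
      AreTwins (s.arr 0) (s.arr 11) (s.arr 5) n (s'.reg 27) (s'.reg 28)) hn rfl rfl (by norm_num)
      ?_ ?_).mono ?_ ?_
  · rintro ⟨x, y, -, h⟩
    omega
  · intro kx s₁ hkx hx hf hI
    refine (Ends.forTo (N := n) (T := n * (40 + 3) + 2 + 20) (fun ky s' =>
      (∃ x y, AreTwins (s.arr 0) (s.arr 11) (s.arr 5) n x y ∧ (x < kx ∨ x = kx ∧ y < ky)) →
        AreTwins (s.arr 0) (s.arr 11) (s.arr 5) n (s'.reg 27) (s'.reg 28))
        (by rw [hf.reg 0 rfl, hn]) rfl rfl (by norm_num) ?_ ?_).mono le_rfl ?_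
    · rintro ⟨x, y, h, h' | ⟨-, h'⟩⟩
      · simpa using hI ⟨x, y, h, h'⟩
      · omega
    · intro ky s₂ hky hy hf₂ hI₂
      have hx₂ : s₂.reg 23 = kx := by rw [hf₂.reg 23 rfl, hx]
      refine (Ends.exec_seq (T := n * (40 + 3) + 2 + selectStep.size) rfl ?_).mono
        (by
          have : selectStep.size ≤ 18 := by decide
          simp only [Prog.size]
          omega) (fun _ _ h => h)
      refine Ends.seq_exec rfl ?_
      refine (Ends.forTo (N := n) (T := 40) (fun kz s' => s'.reg 25 =
        if ∀ z < kz, Agree (s.arr 0) (s.arr 11) (s.arr 5) kx ky z then 1 else 0)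
        (by simp [Prog.exec, hf₂.reg 0 rfl, hf.reg 0 rfl, hn]) rfl rfl (by norm_num) ?_ ?_).mono
        le_rfl ?_
      · simp [Prog.exec]
      · intro kz s₃ hkz hz hf₃ hI₃
        refine Ends.of_loopFree rfl (by decide) ?_
        have hx₃ : s₃.reg 23 = kx := by rw [hf₃.reg 23 rfl, ← hx₂]; simp [Prog.exec]
        have hy₃ : s₃.reg 24 = ky := by rw [hf₃.reg 24 rfl, ← hy]; simp [Prog.exec]
        have a₃ : ∀ a, findProg.writesArr a = false → s₃.arr a = s.arr a := by
          intro a ha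
          have ha' : checkStep.writesArr a = false := by
            simp [findProg, forTo, Prog.writesArr] at ha
            exact ha.1
          rw [hf₃.arr a (by simpa [forTo, Prog.writesArr] using ha')]
          simp only [Prog.exec, State.setReg_arr]
          rw [hf₂.arr a (by simpa [findProg, forTo, Prog.writesArr] using ha),
            hf.arr a (by simpa [findProg, forTo, Prog.writesArr] using ha)]
        have hc := exec_checkStep s₃
        rw [a₃ 0 rfl, a₃ 11 rfl, a₃ 5 rfl, hx₃, hy₃, hz, hI₃] at hc
        simp only [State.setReg_reg, show (25 : ℕ) ≠ 26 by norm_num,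
          show (25 : ℕ) ≠ 3 by norm_num, if_false, hc]
        have hsucc : (∀ z < kz + 1, Agree (s.arr 0) (s.arr 11) (s.arr 5) kx ky z) ↔
            (∀ z < kz, Agree (s.arr 0) (s.arr 11) (s.arr 5) kx ky z) ∧
              Agree (s.arr 0) (s.arr 11) (s.arr 5) kx ky kz := by
          simp only [Nat.lt_succ_iff_lt_or_eq, or_imp, forall_and, forall_eq]
        simp only [hsucc]
        split_ifs <;> tauto
      · rintro s₃ hf₃ h25
        have hx₃ : s₃.reg 23 = kx := by rw [hf₃.reg 23 rfl, ← hx₂]; simp [Prog.exec]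
        have hy₃ : s₃.reg 24 = ky := by rw [hf₃.reg 24 rfl, ← hy]; simp [Prog.exec]
        have h5 : s₃.arr 5 = s.arr 5 := by
          rw [hf₃.arr 5 rfl]
          simp only [Prog.exec, State.setReg_arr]
          rw [hf₂.arr 5 rfl, hf.arr 5 rfl]
        have h27 : s₃.reg 27 = s₂.reg 27 := by rw [hf₃.reg 27 rfl]; simp [Prog.exec]
        have h28 : s₃.reg 28 = s₂.reg 28 := by rw [hf₃.reg 28 rfl]; simp [Prog.exec]
        obtain ⟨e27, e28⟩ := exec_selectStep s₃
        have hsel : (s₃.arr 5 (s₃.reg 23) = 0 ∧ s₃.arr 5 (s₃.reg 24) = 0 ∧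
            s₃.reg 23 < s₃.reg 24 ∧ 0 < s₃.reg 25) ↔
            AreTwins (s.arr 0) (s.arr 11) (s.arr 5) n kx ky := by
          rw [h5, hx₃, hy₃, h25]
          constructor
          · rintro ⟨h₁, h₂, h₃, h₄⟩
            refine ⟨h₃, hky, h₁, h₂, ?_⟩
            by_contra hno
            rw [if_neg hno] at h₄
            exact lt_irrefl _ h₄
          · rintro ⟨h₁, h₂, h₃, h₄, h₅⟩
            exact ⟨h₃, h₄, h₁, by rw [if_pos h₅]; exact one_pos⟩
        rw [hx₃, hy₃] at hsel e27 e28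
        simp only [hsel] at e27 e28
        intro hE
        simp only [State.setReg_reg, show (27 : ℕ) ≠ 24 by norm_num,
          show (27 : ℕ) ≠ 3 by norm_num, show (28 : ℕ) ≠ 24 by norm_num,
          show (28 : ℕ) ≠ 3 by norm_num, if_false, e27, e28]
        by_cases ht : AreTwins (s.arr 0) (s.arr 11) (s.arr 5) n kx ky
        · simp [ht]
        · simp only [ht, if_false, h27, h28]
          apply hI₂
          obtain ⟨x, y, hxy, h⟩ := hE
          refine ⟨x, y, hxy, ?_⟩
          rcases h with h | ⟨rfl, h⟩
          · exact Or.inl h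
          · rcases Nat.lt_succ_iff_lt_or_eq.1 h with h | rfl
            · exact Or.inr ⟨rfl, h⟩
            · exact absurd hxy ht
    · rintro s' - h
      simp only [State.setReg_reg, show (27 : ℕ) ≠ 23 by norm_num,
          show (27 : ℕ) ≠ 3 by norm_num, show (28 : ℕ) ≠ 23 by norm_num,
          show (28 : ℕ) ≠ 3 by norm_num, if_false]
      rintro ⟨x, y, hxy, hlt⟩
      refine h ⟨x, y, hxy, ?_⟩
      have := hxy.lt_n
      omega
  · have : n * (n * (40 + 3) + 2 + 20 + 3) ≤ n * (n * 50 + 60) :=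
      Nat.mul_le_mul_left _ (by omega)
    have := Nat.mul_le_mul_left n (show n * (n * (40 + 3) + 2 + 20 + 3) + 2 + 3 ≤
      n * (n * 50 + 60) + 60 by omega)
    omega
  · rintro s' - h
    obtain ⟨x, y, hxy⟩ := hex
    exact h ⟨x, y, hxy, hxy.lt.trans hxy.lt_n⟩

/-! ### Merging twins -/

theorem sum_map_weight {α : Type*} (N B : ℕ) (f : α → ℕ) (ν : Multiset α) :
    (ν.map fun p => N * B ^ f p).sum = N * code B (ν.map f) := by
  rw [Multiset.sum_map_mul_left, code, Multiset.map_map]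
  rfl

/-- The marks in `T` with offset `a` and stride `N` are the codes of the multisets in `S`. -/
def Marks (N B : ℕ) (T : ℕ → ℕ) (a : ℕ) (S : Set (Multiset ℕ)) : Prop :=
  ∀ k, 0 < T (a + N * k) ↔ ∃ μ ∈ S, code B μ = k

/-- Translates table lookups back into profiles. A mark says only that some profile has the given
code; `code_inj` identifies that profile with the projection of `ν`. Full size of `ν` matches the
fact that profiles have exactly `χ` elements. -/
theorem hit_iff {n χ Δ a b c : ℕ} {V : Type} {G : SimpleGraph V} {M₁ M₂ : Finset V}
    {op : Prop} {T : ℕ → ℕ} {L : List (Multiset (ℕ × ℕ))}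
    (hL : ListsMultisets χ (goodPairs Δ op) L)
    (ha : Marks (2 * n) (χ + 1) T a (profiles G χ Δ M₁))
    (hb : Marks (2 * n) (χ + 1) T b (profiles G χ Δ M₂)) (ν : Multiset (ℕ × ℕ)) :
    ν ∈ L ∧ (mergeLayout n χ Δ op a b c).Hit T ν ↔
      (∀ p ∈ ν, combDeg Δ op p.1 p.2 ≤ Δ) ∧ ν.map Prod.fst ∈ profiles G χ Δ M₁ ∧
        ν.map Prod.snd ∈ profiles G χ Δ M₂ := by
  simp only [Layout.Hit, mergeLayout, sum_map_weight, ha _, hb _, hL ν]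
  constructor
  · rintro ⟨⟨hc, hν⟩, -, ⟨μ₁, h₁, e₁⟩, ⟨μ₂, h₂, e₂⟩⟩
    have k₁ : μ₁ = ν.map Prod.fst := by
      refine code_inj (lt_of_mem_profiles h₁) ?_ (by rw [card_of_mem_profiles h₁]; omega)
        (by rw [Multiset.card_map]; omega) e₁
      intro t ht
      obtain ⟨p, hp, rfl⟩ := Multiset.mem_map.1 ht
      exact (hν p hp).1
    have k₂ : μ₂ = ν.map Prod.snd := by
      refine code_inj (lt_of_mem_profiles h₂) ?_ (by rw [card_of_mem_profiles h₂]; omega)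
        (by rw [Multiset.card_map]; omega) e₂
      intro t ht
      obtain ⟨p, hp, rfl⟩ := Multiset.mem_map.1 ht
      exact (hν p hp).2.1
    exact ⟨fun p hp => (hν p hp).2.2, k₁ ▸ h₁, k₂ ▸ h₂⟩
  · rintro ⟨hν, h₁, h₂⟩
    have hc : Multiset.card ν = χ := by simpa using card_of_mem_profiles h₁
    refine ⟨⟨hc.le, fun p hp => ⟨?_, ?_, hν p hp⟩⟩, by omega, ⟨_, h₁, rfl⟩, ⟨_, h₂, rfl⟩⟩
    · exact lt_of_mem_profiles h₁ _ (Multiset.mem_map_of_mem _ hp)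
    · exact lt_of_mem_profiles h₂ _ (Multiset.mem_map_of_mem _ hp)

/-- Array `0` holds the adjacency matrix of `G`, in rows that start at the entries of
array `11`. -/
def HoldsGraph {n : ℕ} (G : SimpleGraph (Fin n)) (s : State) : Prop :=
  ∀ u v : Fin n, (s.arr 0 (s.arr 11 u + v) = 1 ∧ G.Adj u v) ∨
    (s.arr 0 (s.arr 11 u + v) = 0 ∧ ¬ G.Adj u v)

/-- After `r` rounds: every vertex `u` belongs to the module of `rep u`, whose table has the
identifier stored in array `4`. The vertices that are not representatives are marked in
array `5`. -/
structure RoundInv {n : ℕ} (G : SimpleGraph (Fin n)) (χ Δ r : ℕ) (rep : Fin n → Fin n)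
    (s : State) : Prop where
  alive : ∀ u, s.arr 5 (rep u) = 0
  rep_of_alive : ∀ u : Fin n, s.arr 5 u = 0 → rep u = u
  card : #{u : Fin n | s.arr 5 u = 0} = n - r
  adj : ∀ u w, rep u ≠ rep w → (G.Adj u w ↔ G.Adj (rep u) (rep w))
  id_lt : ∀ u : Fin n, s.arr 5 u = 0 → s.arr 4 u < n + r
  marks : ∀ u : Fin n, s.arr 5 u = 0 → Marks (2 * n) (χ + 1) (s.arr 6) (s.arr 4 u)
    (profiles G χ Δ {w | rep w = u})
  fresh : ∀ x, n + r ≤ x % (2 * n) → s.arr 6 x = 0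
  answer : 0 < r → ∃ u : Fin n, s.arr 5 u = 0 ∧
    (s.reg 13 = 1 ∧ (profiles G χ Δ {w | rep w = u}).Nonempty ∨
      s.reg 13 = 0 ∧ ¬ (profiles G χ Δ {w | rep w = u}).Nonempty)

theorem RoundInv.congr {n : ℕ} {G : SimpleGraph (Fin n)} {χ Δ r : ℕ} {rep : Fin n → Fin n}
    {s s' : State} (h : RoundInv G χ Δ r rep s) (h4 : s'.arr 4 = s.arr 4)
    (h5 : s'.arr 5 = s.arr 5) (h6 : s'.arr 6 = s.arr 6) (h13 : s'.reg 13 = s.reg 13) :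
    RoundInv G χ Δ r rep s' := by
  obtain ⟨h₁, h₂, h₃, h₄, h₅, h₆, h₇, h₈⟩ := h
  simp only [← h4] at h₅ h₆
  simp only [← h5] at h₁ h₂ h₃ h₅ h₆ h₈
  simp only [← h6] at h₆ h₇
  simp only [← h13] at h₈
  exact ⟨h₁, h₂, h₃, h₄, h₅, h₆, h₇, h₈⟩

/-- `IsCograph.exists_twins` applied to the set of representatives, of which `n - r ≥ 2` are left.
-/
theorem RoundInv.exists_areTwins {n : ℕ} {G : SimpleGraph (Fin n)} (hG : IsCograph G)
    {χ Δ r : ℕ} {rep : Fin n → Fin n} {s : State} (h : RoundInv G χ Δ r rep s)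
    (hr : r + 1 < n) (hs : HoldsGraph G s) :
    ∃ x y, AreTwins (s.arr 0) (s.arr 11) (s.arr 5) n x y := by
  have hnt : ({u : Fin n | s.arr 5 u = 0} : Set (Fin n)).Nontrivial := by
    have := h.card
    have h₁ : 1 < #{u : Fin n | s.arr 5 u = 0} := by omega
    obtain ⟨a, ha, b, hb, hab⟩ := one_lt_card.1 h₁
    exact ⟨a, by simpa using ha, b, by simpa using hb, hab⟩
  obtain ⟨x, hx, y, hy, hxy, htw⟩ := hG.exists_twins _ hnt
  have hag : ∀ z : Fin n, s.arr 5 z = 0 → z ≠ x → z ≠ y →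
      s.arr 0 (s.arr 11 x + z) = s.arr 0 (s.arr 11 y + z) := by
    intro z hz hzx hzy
    have := htw z hz hzx hzy
    rcases hs x z with ⟨e₁, a₁⟩ | ⟨e₁, a₁⟩ <;> rcases hs y z with ⟨e₂, a₂⟩ | ⟨e₂, a₂⟩ <;>
      first | exact e₁.trans e₂.symm | tauto
  rcases lt_or_gt_of_ne hxy with hlt | hlt
  · refine ⟨x, y, hlt, y.2, hx, hy, fun z hz h₁ h₂ h₃ => ?_⟩
    exact hag ⟨z, hz⟩ h₁ (fun h => h₂ (congrArg Fin.val h)) (fun h => h₃ (congrArg Fin.val h))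
  · refine ⟨y, x, hlt, x.2, hy, hx, fun z hz h₁ h₂ h₃ => ?_⟩
    exact (hag ⟨z, hz⟩ h₁ (fun h => h₃ (congrArg Fin.val h))
      (fun h => h₂ (congrArg Fin.val h))).symm

/-- The effect of one round on the representatives and the tables. -/
theorem RoundInv.merge {n : ℕ} {G : SimpleGraph (Fin n)} {χ Δ r : ℕ} {rep : Fin n → Fin n}
    {s s' : State} {x y : Fin n} {L : List (Multiset (ℕ × ℕ))} {l : Layout (ℕ × ℕ)}
    (h : RoundInv G χ Δ r rep s) (hr : r + 1 < n) (hs : HoldsGraph G s)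
    (htw : AreTwins (s.arr 0) (s.arr 11) (s.arr 5) n x y)
    (hl : l = mergeLayout n χ Δ (G.Adj x y) (s.arr 4 x) (s.arr 4 y) (n + r))
    (hL : ListsMultisets χ (goodPairs Δ (G.Adj x y)) L)
    (h4 : s'.arr 4 = Function.update (s.arr 4) x (n + r))
    (h5 : s'.arr 5 = Function.update (s.arr 5) y 1)
    (hmark : ∀ μ ∈ L, l.Hit (s.arr 6) μ → s'.arr 6 (l.c + (μ.map l.wc).sum) = 1)
    (hkeep : ∀ k, (¬ ∃ μ ∈ L, l.Hit (s.arr 6) μ ∧ l.c + (μ.map l.wc).sum = k) →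
      s'.arr 6 k = s.arr 6 k)
    (h13 : s'.reg 13 = 1 ∧ (∃ μ ∈ L, l.Hit (s.arr 6) μ) ∨
      s'.reg 13 = 0 ∧ ¬ ∃ μ ∈ L, l.Hit (s.arr 6) μ) :
    RoundInv G χ Δ (r + 1) (fun u => if rep u = y then x else rep u) s' := by
  have hxy : x ≠ y := fun e => lt_irrefl _ (e ▸ htw.lt)
  have alive' : ∀ u : Fin n, s'.arr 5 u = 0 ↔ u ≠ y ∧ s.arr 5 u = 0 := by
    intro u
    rw [h5]
    by_cases hu : u = y
    · simp [hu]
    · have : (u : ℕ) ≠ y := fun e => hu (Fin.ext e)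
      simp [hu, Function.update_of_ne this]
  have twin : ∀ z : Fin n, s.arr 5 z = 0 → z ≠ x → z ≠ y → (G.Adj x z ↔ G.Adj y z) := by
    intro z hz hzx hzy
    have := htw.agree z z.2 hz (fun e => hzx (Fin.ext e)) (fun e => hzy (Fin.ext e))
    rcases hs x z with ⟨e₁, a₁⟩ | ⟨e₁, a₁⟩ <;> rcases hs y z with ⟨e₂, a₂⟩ | ⟨e₂, a₂⟩ <;>
      first | tauto | omega
  have hmod : ∀ w, (if rep w = y then x else rep w) = x ↔ rep w = x ∨ rep w = y := by
    intro w
    by_cases hw : rep w = y <;> simp [hw]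
  have hmod' : ∀ u, u ≠ x → u ≠ y → ∀ w, (if rep w = y then x else rep w) = u ↔ rep w = u := by
    intro u hux huy w
    by_cases hw : rep w = y
    · simp [hw, Ne.symm hux, Ne.symm huy]
    · simp [hw]
  have hunion : ({w | (if rep w = y then x else rep w) = x} : Finset (Fin n)) =
      ({w | rep w = x} : Finset (Fin n)) ∪ ({w | rep w = y} : Finset (Fin n)) := by
    ext w
    simp only [mem_filter, mem_univ, true_and, mem_union, hmod]
  have hdisj : Disjoint ({w | rep w = x} : Finset (Fin n)) ({w | rep w = y} : Finset (Fin n)) := by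
    rw [disjoint_left]
    intro w hw hw'
    simp only [mem_filter, mem_univ, true_and] at hw hw'
    exact hxy (hw.symm.trans hw')
  have hop : ∀ u ∈ ({w | rep w = x} : Finset (Fin n)), ∀ v ∈ ({w | rep w = y} : Finset (Fin n)),
      G.Adj u v ↔ G.Adj x y := by
    intro u hu v hv
    simp only [mem_filter, mem_univ, true_and] at hu hv
    have := h.adj u v (by rw [hu, hv]; exact hxy)
    rwa [hu, hv] at this
  -- By `hop`, the modules of `x` and `y` are completely joined or have no edges between them,
  -- according to whether `x` and `y` are adjacent; the kind of merge is therefore one table lookup.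
  have hhit := hit_iff (c := n + r) hL (h.marks x htw.left) (h.marks y htw.right)
  rw [← hl] at hhit
  have hwc : ∀ μ : Multiset (ℕ × ℕ), l.c + (μ.map l.wc).sum =
      n + r + 2 * n * code (χ + 1) (μ.map fun p => combType Δ (G.Adj x y) p.1 p.2) := by
    intro μ
    subst hl
    simp only [mergeLayout, sum_map_weight]
  -- The residue of an address modulo `2 * n` is the identifier of its module; the new identifier `n
  -- + r` is below `2 * n` and has not been used.
  have hcmod : ∀ k, (n + r + 2 * n * k) % (2 * n) = n + r := by
    intro k
    rw [Nat.add_mul_mod_self_left, Nat.mod_eq_of_lt (by omega)]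
  have hprof : ∀ k, (∃ μ ∈ L, l.Hit (s.arr 6) μ ∧ l.c + (μ.map l.wc).sum = n + r + 2 * n * k) ↔
      ∃ μ ∈ profiles G χ Δ {w | (if rep w = y then x else rep w) = x}, code (χ + 1) μ = k := by
    intro k
    rw [hunion]
    simp only [hwc, mem_profiles_union hdisj hop]
    constructor
    · rintro ⟨ν, hν, hit, e⟩
      obtain ⟨h₁, h₂, h₃⟩ := (hhit ν).1 ⟨hν, hit⟩
      exact ⟨_, ⟨ν, h₁, h₂, h₃, rfl⟩,
        Nat.eq_of_mul_eq_mul_left (by omega : 0 < 2 * n) (Nat.add_left_cancel e)⟩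
    · rintro ⟨_, ⟨ν, h₁, h₂, h₃, rfl⟩, rfl⟩
      obtain ⟨h₄, h₅⟩ := (hhit ν).2 ⟨h₁, h₂, h₃⟩
      exact ⟨ν, h₄, h₅, rfl⟩
  have hkeep' : ∀ k, k % (2 * n) ≠ n + r → s'.arr 6 k = s.arr 6 k := by
    intro k hk
    refine hkeep k ?_
    rintro ⟨μ, -, -, rfl⟩
    rw [hwc, hcmod] at hk
    exact hk rfl
  refine ⟨fun u => ?_, fun u hu => ?_, ?_, fun u w huw => ?_, fun u hu => ?_, fun u hu => ?_,
    fun k hk => ?_, fun _ => ⟨x, ?_, ?_⟩⟩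
  · rw [alive']
    by_cases hu : rep u = y
    · simpa [hu, hxy] using htw.left
    · simpa [hu] using h.alive u
  · rw [alive'] at hu
    simp [h.rep_of_alive u hu.2, hu.1]
  · have : ({u : Fin n | s'.arr 5 u = 0} : Finset (Fin n)) =
        ({u : Fin n | s.arr 5 u = 0} : Finset (Fin n)).erase y := by
      ext u
      simp [alive']
    rw [this, card_erase_of_mem (by simpa using htw.right), h.card]
    omega
  -- Vertices of merged modules are now represented by `x` instead of `y`; the twin property says
  -- that the other representatives do not notice.
  · by_cases hu : rep u = y <;> by_cases hw : rep w = y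
    · simp [hu, hw] at huw
    · simp only [hu, hw, if_true, if_false] at huw ⊢
      rw [h.adj u w (by rw [hu]; exact Ne.symm hw), hu]
      exact (twin _ (h.alive w) (Ne.symm huw) hw).symm
    · simp only [hu, hw, if_true, if_false] at huw ⊢
      rw [h.adj u w (by rw [hw]; exact hu), hw, G.adj_comm, G.adj_comm _ x]
      exact (twin _ (h.alive u) huw hu).symm
    · simp only [hu, hw, if_false] at huw ⊢
      exact h.adj u w huw
  · rw [alive'] at hu
    rw [h4]
    by_cases hux : u = x
    · simp [hux]
    · rw [Function.update_of_ne fun e => hux (Fin.ext e)]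
      have := h.id_lt u hu.2
      omega
  · rw [alive'] at hu
    rw [h4]
    by_cases hux : u = x
    · subst hux
      intro k
      rw [Function.update_self, ← hprof]
      constructor
      · intro hpos
        by_contra hno
        -- A mark in the region of the new identifier must come from this round, since the region
        -- was empty before.
        rw [hkeep _ hno, h.fresh _ (by rw [hcmod])] at hpos
        exact lt_irrefl _ hpos
      · rintro ⟨μ, hμ, hit, e⟩
        rw [← e, hmark μ hμ hit]
        exact one_pos
    · rw [Function.update_of_ne fun e => hux (Fin.ext e)]
      intro k
      have hlt := h.id_lt u hu.2
      rw [hkeep' _ (by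
        rw [Nat.add_mul_mod_self_left, Nat.mod_eq_of_lt (by omega)]
        omega)]
      simp only [hmod' u hux hu.1]
      exact h.marks u hu.2 k
  · rw [hkeep' _ (by omega)]
    exact h.fresh k (by omega)
  · rw [alive']
    exact ⟨hxy, htw.left⟩
  · have : (∃ μ ∈ L, l.Hit (s.arr 6) μ) ↔
        (profiles G χ Δ {w | (if rep w = y then x else rep w) = x}).Nonempty := by
      constructor
      · rintro ⟨μ, hμ, hit⟩
        obtain ⟨ν, hν, -⟩ := (hprof _).1 ⟨μ, hμ, hit, hwc μ⟩
        exact ⟨ν, hν⟩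
      · rintro ⟨ν, hν⟩
        obtain ⟨μ, hμ, hit, -⟩ := (hprof _).2 ⟨ν, hν, rfl⟩
        exact ⟨μ, hμ, hit⟩
    rwa [← this]

/-- Merge a pair of twins. -/
def roundProg : Prog :=
  findProg ;; (.load 29 11 27 ;; .add 29 29 28 ;; .load 32 0 29) ;; listProg ;; applyProg ;;
  (.add 31 0 22 ;; .store 4 27 31 ;; .const 3 1 ;; .store 5 28 3)

/-- A bound for the running time of a round. -/
def roundTime (n χ Δ : ℕ) : ℕ :=
  (n * (n * (n * 50 + 60) + 60) + 2) +
    (3 + (((Δ + 2) * (Δ + 2) * ((Δ + 2) * (Δ + 2)) *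
      (listBound χ ((Δ + 2) * (Δ + 2) * ((Δ + 2) * (Δ + 2))) * (χ * 13 + 11) + Δ * 4 + 63) + 13) +
    (listBound χ ((Δ + 2) * (Δ + 2) * ((Δ + 2) * (Δ + 2))) * 20 + 3 + 4)))

theorem ends_roundProg {n : ℕ} {G : SimpleGraph (Fin n)} (hG : IsCograph G) {χ Δ r : ℕ}
    {rep : Fin n → Fin n} {s : State} (h : RoundInv G χ Δ r rep s) (hr : r + 1 < n)
    (hg : HoldsGraph G s) (hs : Ready n χ Δ s) (h22 : s.reg 22 = r) :
    Ends roundProg s (roundTime n χ Δ) fun s' => ∃ rep', RoundInv G χ Δ (r + 1) rep' s' := by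
  classical
  refine Ends.seq (ends_findProg hs.r0 (h.exists_areTwins hG hr hg)) fun s₁ hf₁ htw => ?_
  obtain ⟨x, hx⟩ : ∃ x : Fin n, s₁.reg 27 = x := ⟨⟨_, htw.lt.trans htw.lt_n⟩, rfl⟩
  obtain ⟨y, hy⟩ : ∃ y : Fin n, s₁.reg 28 = y := ⟨⟨_, htw.lt_n⟩, rfl⟩
  rw [hx, hy] at htw
  refine Ends.exec_seq rfl ?_
  set s₂ := (Prog.load 29 11 27 ;; Prog.add 29 29 28 ;; Prog.load 32 0 29).exec s₁ with hs₂
  have hf₂ : Frame (Prog.load 29 11 27 ;; Prog.add 29 29 28 ;; Prog.load 32 0 29) s₁ s₂ := by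
    obtain ⟨t, -, h⟩ := (Prog.load 29 11 27 ;; Prog.add 29 29 28 ;;
      Prog.load 32 0 29).exists_runs_exec rfl s₁
    exact h.frame
  have hop : (0 < s₂.reg 32) = G.Adj x y := by
    have : s₂.reg 32 = s.arr 0 (s.arr 11 x + y) := by
      simp [hs₂, Prog.exec, hx, hy, hf₁.arr 0 rfl, hf₁.arr 11 rfl]
    rw [this]
    rcases hg x y with ⟨e, a⟩ | ⟨e, a⟩ <;> simp [e, a]
  have hready : Ready n χ Δ s₂ := by
    refine hs.congr (fun r hr => ?_) (fun a ha => ?_)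
    · simp only [List.mem_cons, List.not_mem_nil, or_false] at hr
      rcases hr with rfl | rfl | rfl | rfl | rfl | rfl <;>
        rw [hf₂.reg _ rfl, hf₁.reg _ rfl]
    · simp only [List.mem_cons, List.not_mem_nil, or_false] at ha
      rcases ha with rfl | rfl | rfl <;> rw [hf₂.arr _ rfl, hf₁.arr _ rfl]
  refine Ends.seq (ends_listProg hready) fun s₃ hf₃ hl => ?_
  rw [hf₂.arr 4 rfl, hf₁.arr 4 rfl, hf₂.reg 27 rfl, hx, hf₂.reg 28 rfl, hy, hf₂.reg 22 rfl,
    hf₁.reg 22 rfl, h22, hop] at hl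
  obtain ⟨L, hH, hL, hlen⟩ := hl
  -- Identifiers of live modules are below `n + r < 2 * n`, so addresses of old modules and of the
  -- new one differ modulo `2 * n`. This is the disjointness that `ends_applyProg` needs.
  have sep : ∀ v : Fin n, s.arr 5 v = 0 → ∀ j k,
      s.arr 4 v + 2 * n * j ≠ n + r + 2 * n * k := by
    intro v hv j k e
    have hlt := h.id_lt v hv
    have := congrArg (· % (2 * n)) e
    simp only [Nat.add_mul_mod_self_left] at this
    rw [Nat.mod_eq_of_lt (by omega), Nat.mod_eq_of_lt (by omega)] at this
    omega
  have h6 : s₃.arr 6 = s.arr 6 := by rw [hf₃.arr 6 rfl, hf₂.arr 6 rfl, hf₁.arr 6 rfl]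
  refine Ends.seq_exec (T := listBound χ ((Δ + 2) * (Δ + 2) * ((Δ + 2) * (Δ + 2))) * 20 + 3) rfl
    ((ends_applyProg hH ?_ ?_).mono (by omega) ?_)
  · intro μ _ ν _
    simp only [mergeLayout, sum_map_weight]
    exact sep x htw.left _ _
  · intro μ _ ν _
    simp only [mergeLayout, sum_map_weight]
    exact sep y htw.right _ _
  · rintro s₄ hf₄ ⟨hT, hans⟩
    rw [h6] at hT hans
    have g27 : s₄.reg 27 = x := by rw [hf₄.reg 27 rfl, hf₃.reg 27 rfl, hf₂.reg 27 rfl, hx]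
    have g28 : s₄.reg 28 = y := by rw [hf₄.reg 28 rfl, hf₃.reg 28 rfl, hf₂.reg 28 rfl, hy]
    have g22 : s₄.reg 22 = r := by
      rw [hf₄.reg 22 rfl, hf₃.reg 22 rfl, hf₂.reg 22 rfl, hf₁.reg 22 rfl, h22]
    have g0 : s₄.reg 0 = n := by
      rw [hf₄.reg 0 rfl, hf₃.reg 0 rfl, hf₂.reg 0 rfl, hf₁.reg 0 rfl, hs.r0]
    have g4 : s₄.arr 4 = s.arr 4 := by
      rw [hf₄.arr 4 rfl, hf₃.arr 4 rfl, hf₂.arr 4 rfl, hf₁.arr 4 rfl]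
    have g5 : s₄.arr 5 = s.arr 5 := by
      rw [hf₄.arr 5 rfl, hf₃.arr 5 rfl, hf₂.arr 5 rfl, hf₁.arr 5 rfl]
    refine ⟨_, h.merge hr hg htw rfl hL ?_ ?_ ?_ ?_ ?_⟩
    · simp [Prog.exec, g27, g22, g0, g4]
    · simp [Prog.exec, g28, g5]
    · intro μ hμ hit
      have := hT ((mergeLayout n χ Δ (G.Adj x y) (s.arr 4 x) (s.arr 4 y) (n + r)).c +
        (μ.map (mergeLayout n χ Δ (G.Adj x y) (s.arr 4 x) (s.arr 4 y) (n + r)).wc).sum)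
      rw [if_pos ⟨μ, hμ, hit, rfl⟩] at this
      simpa [Prog.exec] using this
    · intro k hk
      have := hT k
      rw [if_neg hk] at this
      simpa [Prog.exec] using this
    · have : (((Prog.add 31 0 22 ;; Prog.store 4 27 31 ;; Prog.const 3 1 ;;
        Prog.store 5 28 3).exec s₄)).reg 13 = s₄.reg 13 := by simp [Prog.exec]
      rw [this, hans]
      split_ifs with hc
      · exact Or.inl ⟨rfl, hc⟩
      · exact Or.inr ⟨rfl, hc⟩

/-! ### The program -/

/-- Compute the parameters of the algorithm. -/
def paramProg : Prog :=
  (.const 3 1 ;; .add 6 11 3) ;; mulProg 7 6 6 ;; mulProg 8 7 7 ;;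
  (.const 3 1 ;; .add 9 1 3 ;; .add 10 0 0 ;; .sub 21 0 3 ;; copyReg 14 10 ;; .const 15 0 ;;
    .const 16 0)

/-- Go on to the next type. -/
def typeNext : Prog :=
  copyReg 14 18 ;; .const 3 1 ;; .add 16 16 3 ;; .ifLt 16 6 skip (.const 16 0 ;; .add 15 15 3)

/-- Fill the tables of the weights, sizes and degrees of types. -/
def typeProg : Prog :=
  forTo 17 7 ((.store 1 17 14 ;; .store 2 17 15 ;; .store 3 17 16) ;; mulProg 18 14 9 ;; typeNext)

/-- Mark the profile of a single vertex for vertex `23`, and fill in the start of row `23` of the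
adjacency matrix. -/
def vertexStep : Prog :=
  .store 4 23 23 ;; .add 20 18 23 ;; .const 3 1 ;; .store 6 20 3 ;; .store 11 23 61 ;;
  .add 61 61 0

/-- Set up the tables of single vertices. -/
def vertexProg : Prog :=
  (.load 18 1 6 ;; .const 3 1 ;; .sub 19 1 3) ;; mulProg 20 10 19 ;;
  (.add 18 18 20 ;; .const 61 0) ;; forTo 23 0 vertexStep

/-- Decide colorability when `χ (Δ + 1) < n`. -/
def mergeProg : Prog :=
  paramProg ;; typeProg ;; vertexProg ;; forTo 22 21 roundProg ;; copyReg 0 13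

/-- Decide Defective Coloring on cographs. -/
def cographProg : Prog :=
  (.ifLt 0 1 (copyReg 1 0) skip ;; .const 3 1 ;; .add 11 2 3) ;; mulProg 12 11 1 ;;
  .ifLt 12 0 mergeProg (.const 0 1)

theorem Ends.exec_seq_frame {p q : Prog} {s : State} {T : ℕ} {Q : State → Prop}
    (hp : p.loopFree = true) (h : Frame p s (p.exec s) → Ends q (p.exec s) T Q) :
    Ends (p ;; q) s (p.size + T) Q := by
  refine Ends.exec_seq hp (h ?_)
  obtain ⟨t, -, hr⟩ := p.exists_runs_exec hp s
  exact hr.frame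

theorem ends_paramProg {n χ Δ : ℕ} {s : State} (h0 : s.reg 0 = n) (h1 : s.reg 1 = χ)
    (h11 : s.reg 11 = Δ + 1) :
    Ends paramProg s ((Δ + 2) * (Δ + 2) * 4 + Δ * 4 + 30) fun s' =>
      s'.reg 6 = Δ + 2 ∧ s'.reg 7 = (Δ + 2) * (Δ + 2) ∧
        s'.reg 8 = (Δ + 2) * (Δ + 2) * ((Δ + 2) * (Δ + 2)) ∧ s'.reg 9 = χ + 1 ∧
        s'.reg 10 = 2 * n ∧ s'.reg 21 = n - 1 ∧ s'.reg 14 = 2 * n ∧ s'.reg 15 = 0 ∧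
        s'.reg 16 = 0 := by
  refine (Ends.exec_seq_frame rfl fun hf₁ => ?_).mono
    (T := 2 + (((Δ + 2) * 4 + 3) + (((Δ + 2) * (Δ + 2) * 4 + 3) + 8))) (by omega) fun _ _ h => h
  have h6 : ((Prog.const 3 1 ;; Prog.add 6 11 3).exec s).reg 6 = Δ + 2 := by
    simp [Prog.exec, h11]
  refine Ends.seq ((Ends.mul (z := 7) (x := 6) (y := 6) rfl rfl (by norm_num)).mono
    (by rw [h6]) fun _ _ h => h) fun s₂ hf₂ h₂ => ?_
  rw [h6] at h₂
  refine Ends.seq ((Ends.mul (z := 8) (x := 7) (y := 7) rfl rfl (by norm_num)).mono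
    (by rw [h₂]) fun _ _ h => h) fun s₃ hf₃ h₃ => ?_
  rw [h₂] at h₃
  have g6 : s₃.reg 6 = Δ + 2 := by rw [hf₃.reg 6 rfl, hf₂.reg 6 rfl, h6]
  have g7 : s₃.reg 7 = (Δ + 2) * (Δ + 2) := by rw [hf₃.reg 7 rfl, h₂]
  have g0 : s₃.reg 0 = n := by rw [hf₃.reg 0 rfl, hf₂.reg 0 rfl, hf₁.reg 0 rfl, h0]
  have g1 : s₃.reg 1 = χ := by rw [hf₃.reg 1 rfl, hf₂.reg 1 rfl, hf₁.reg 1 rfl, h1]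
  refine Ends.of_loopFree rfl (by decide) ?_
  simp [Prog.exec, copyReg, g0, g1, g6, g7, h₃, two_mul]

/-- Registers `14`, `15`, `16` hold the weight, quotient and remainder of the current type, updated
by one multiplication by `χ + 1` and by a two-digit counter, so that no division is needed. -/
theorem ends_typeProg {n χ Δ : ℕ} {s : State} (h0 : s.reg 0 = n) (h1 : s.reg 1 = χ)
    (h11 : s.reg 11 = Δ + 1) (h6 : s.reg 6 = Δ + 2) (h7 : s.reg 7 = (Δ + 2) * (Δ + 2))
    (h8 : s.reg 8 = (Δ + 2) * (Δ + 2) * ((Δ + 2) * (Δ + 2))) (h9 : s.reg 9 = χ + 1)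
    (h14 : s.reg 14 = 2 * n) (h15 : s.reg 15 = 0) (h16 : s.reg 16 = 0) :
    Ends typeProg s ((Δ + 2) * (Δ + 2) * (χ * 4 + 30) + 2) (Ready n χ Δ) := by
  refine (Ends.forTo (N := (Δ + 2) * (Δ + 2)) (T := 3 + (((χ + 1) * 4 + 3) + 9)) (fun t s' =>
    s'.reg 14 = 2 * n * (χ + 1) ^ t ∧ s'.reg 15 = t / (Δ + 2) ∧ s'.reg 16 = t % (Δ + 2) ∧
    (∀ u < t, s'.arr 1 u = 2 * n * (χ + 1) ^ u) ∧ (∀ u < t, s'.arr 2 u = u / (Δ + 2)) ∧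
    (∀ u < t, s'.arr 3 u = u % (Δ + 2))) h7 rfl rfl (by norm_num) ?_ ?_).mono
    (Nat.add_le_add_right (Nat.mul_le_mul_left _ (by omega)) _) ?_
  · simp [h14, h15, h16]
  · rintro t s₁ ht hi hf ⟨i14, i15, i16, i1, i2, i3⟩
    have g9 : s₁.reg 9 = χ + 1 := by rw [hf.reg 9 rfl, h9]
    have g6 : s₁.reg 6 = Δ + 2 := by rw [hf.reg 6 rfl, h6]
    refine Ends.exec_seq_frame rfl fun hf₂ => ?_
    refine Ends.seq ((Ends.mul (z := 18) (x := 14) (y := 9) rfl rfl (by norm_num)).mono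
      (by rw [hf₂.reg 9 rfl, g9]) fun _ _ h => h) fun s₃ hf₃ h18 => ?_
    have k18 : s₃.reg 18 = 2 * n * (χ + 1) ^ (t + 1) := by
      rw [h18, hf₂.reg 14 rfl, hf₂.reg 9 rfl, i14, g9]
      ring
    have k15 : s₃.reg 15 = t / (Δ + 2) := by rw [hf₃.reg 15 rfl, hf₂.reg 15 rfl, i15]
    have k16 : s₃.reg 16 = t % (Δ + 2) := by rw [hf₃.reg 16 rfl, hf₂.reg 16 rfl, i16]
    have k6 : s₃.reg 6 = Δ + 2 := by rw [hf₃.reg 6 rfl, hf₂.reg 6 rfl, g6]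
    have upd : ∀ (f g : ℕ → ℕ) (v : ℕ), (∀ u < t, f u = g u) → v = g t →
        ∀ u < t + 1, Function.update f t v u = g u := by
      intro f g v h hv u hu
      by_cases hut : u = t
      · rw [hut, Function.update_self, hv]
      · rw [Function.update_of_ne hut]
        exact h u (by omega)
    have k1 : ∀ u < t + 1, s₃.arr 1 u = 2 * n * (χ + 1) ^ u := by
      rw [hf₃.arr 1 rfl]
      simpa [Prog.exec, hi] using upd _ (fun u => 2 * n * (χ + 1) ^ u) _ i1 i14
    have k2 : ∀ u < t + 1, s₃.arr 2 u = u / (Δ + 2) := by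
      rw [hf₃.arr 2 rfl]
      simpa [Prog.exec, hi] using upd _ (fun u => u / (Δ + 2)) _ i2 i15
    have k3 : ∀ u < t + 1, s₃.arr 3 u = u % (Δ + 2) := by
      rw [hf₃.arr 3 rfl]
      simpa [Prog.exec, hi] using upd _ (fun u => u % (Δ + 2)) _ i3 i16
    refine Ends.of_loopFree rfl (by decide) ?_
    have hmod := Nat.mod_lt t (show 0 < Δ + 2 by omega)
    have e1 : 1 / (Δ + 2) = 0 := Nat.div_eq_of_lt (by omega)
    have e1' : 1 % (Δ + 2) = 1 := Nat.mod_eq_of_lt (by omega)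
    rw [Nat.add_div (by omega), Nat.add_mod, e1, e1']
    by_cases hc : t % (Δ + 2) + 1 < Δ + 2
    · have hle : t % (Δ + 2) ≤ Δ := by omega
      refine ⟨?_, ?_, ?_, ?_, ?_, ?_⟩
      · simp [typeNext, copyReg, skip, Prog.exec, k16, k6, hc, k18]
      · simp [typeNext, copyReg, skip, Prog.exec, k16, k6, hc, k15, hle]
      · simp [typeNext, copyReg, skip, Prog.exec, k16, k6, hc, Nat.mod_eq_of_lt hc]
      · simpa [typeNext, copyReg, skip, Prog.exec, k16, k6, hc] using k1
      · simpa [typeNext, copyReg, skip, Prog.exec, k16, k6, hc] using k2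
      · simpa [typeNext, copyReg, skip, Prog.exec, k16, k6, hc] using k3
    · have hc' : t % (Δ + 2) + 1 = Δ + 2 := by omega
      refine ⟨?_, ?_, ?_, ?_, ?_, ?_⟩
      · simp [typeNext, copyReg, Prog.exec, k16, k6, hc', k18]
      · simp [typeNext, copyReg, Prog.exec, k16, k6, hc', k15]
      · simp [typeNext, copyReg, Prog.exec, k16, k6, hc']
      · simpa [typeNext, copyReg, Prog.exec, k16, k6, hc'] using k1
      · simpa [typeNext, copyReg, Prog.exec, k16, k6, hc'] using k2
      · simpa [typeNext, copyReg, Prog.exec, k16, k6, hc'] using k3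
  · rintro s' hf ⟨-, -, -, i1, i2, i3⟩
    exact ⟨by rw [hf.reg 0 rfl, h0], by rw [hf.reg 1 rfl, h1], by rw [hf.reg 6 rfl, h6],
      by rw [hf.reg 7 rfl, h7], by rw [hf.reg 8 rfl, h8], by rw [hf.reg 11 rfl, h11], i1, i2, i3⟩

/-- The number `(χ + 1) ^ (Δ + 2) + (χ - 1)` is the code of the only profile of a single vertex: one
class of type `Δ + 2`, and `χ - 1` classes of type `0`, each of weight `1`. -/
theorem ends_vertexProg {n χ Δ : ℕ} {s : State} (hs : Ready n χ Δ s) (h10 : s.reg 10 = 2 * n)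
    (h6 : ∀ x, s.arr 6 x = 0) :
    Ends vertexProg s (χ * 4 + n * 9 + 20) fun s' =>
      (∀ v < n, s'.arr 4 v = v) ∧ (∀ v < n, s'.arr 11 v = v * n) ∧
      ∀ x, s'.arr 6 x = if ∃ v < n, x = v + 2 * n * ((χ + 1) ^ (Δ + 2) + (χ - 1)) then 1 else 0 := by
  refine (Ends.exec_seq_frame rfl fun hf₁ => ?_).mono
    (T := 3 + (((χ - 1) * 4 + 3) + (2 + (n * (6 + 3) + 2)))) (by omega) fun _ _ h => h
  have h19 : ((Prog.load 18 1 6 ;; Prog.const 3 1 ;; Prog.sub 19 1 3).exec s).reg 19 = χ - 1 := by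
    simp [Prog.exec, hs.r1]
  have h18 : ((Prog.load 18 1 6 ;; Prog.const 3 1 ;; Prog.sub 19 1 3).exec s).reg 18 =
      2 * n * (χ + 1) ^ (Δ + 2) := by
    simp [Prog.exec, hs.r6, hs.weight (Δ + 2) (by nlinarith)]
  refine Ends.seq ((Ends.mul (z := 20) (x := 10) (y := 19) rfl rfl (by norm_num)).mono
    (by rw [h19]) fun _ _ h => h) fun s₂ hf₂ h20 => ?_
  rw [hf₁.reg 10 rfl, h10, h19] at h20
  have k18 : s₂.reg 18 = 2 * n * (χ + 1) ^ (Δ + 2) := by rw [hf₂.reg 18 rfl, h18]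
  refine Ends.exec_seq_frame rfl fun hf₃ => ?_
  refine (Ends.forTo (N := n) (T := 6) (fun k s' =>
    s'.reg 61 = k * n ∧ (∀ v < k, s'.arr 4 v = v) ∧ (∀ v < k, s'.arr 11 v = v * n) ∧
    ∀ x, s'.arr 6 x = if ∃ v < k, x = v + 2 * n * ((χ + 1) ^ (Δ + 2) + (χ - 1)) then 1 else 0)
    ?_ rfl rfl (by norm_num) ?_ ?_).mono le_rfl (fun _ _ h => h.2)
  · rw [hf₃.reg 0 rfl, hf₂.reg 0 rfl, hf₁.reg 0 rfl, hs.r0]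
  · simp [Prog.exec, hf₂.arr 6 rfl, h6]
  · rintro k s₄ hk hi hf₄ ⟨i61, i4, i11, i6⟩
    have g0 : s₄.reg 0 = n := by
      rw [hf₄.reg 0 rfl, hf₃.reg 0 rfl, hf₂.reg 0 rfl, hf₁.reg 0 rfl, hs.r0]
    have g18 : s₄.reg 18 = 2 * n * ((χ + 1) ^ (Δ + 2) + (χ - 1)) := by
      rw [hf₄.reg 18 rfl]
      simp [Prog.exec, k18, h20, mul_add]
    refine Ends.of_loopFree rfl (by decide) ⟨?_, ?_, ?_, ?_⟩
    · simp [vertexStep, Prog.exec, g0, i61, add_mul]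
    · intro v hv
      by_cases hvk : v = k
      · simp [vertexStep, Prog.exec, hi, hvk]
      · simp [vertexStep, Prog.exec, hi, hvk, i4 v (by omega)]
    · intro v hv
      by_cases hvk : v = k
      · simp [vertexStep, Prog.exec, hi, hvk, i61]
      · simp [vertexStep, Prog.exec, hi, hvk, i11 v (by omega)]
    · intro x
      have hsucc : (∃ v < k + 1, x = v + 2 * n * ((χ + 1) ^ (Δ + 2) + (χ - 1))) ↔
          (∃ v < k, x = v + 2 * n * ((χ + 1) ^ (Δ + 2) + (χ - 1))) ∨
            x = 2 * n * ((χ + 1) ^ (Δ + 2) + (χ - 1)) + k := by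
        simp only [Nat.lt_succ_iff_lt_or_eq, or_and_right, exists_or, exists_eq_left]
        rw [add_comm k]
      have hx : (vertexStep.exec s₄).arr 6 x =
          if x = 2 * n * ((χ + 1) ^ (Δ + 2) + (χ - 1)) + k then 1 else s₄.arr 6 x := by
        simp [vertexStep, Prog.exec, hi, g18, Function.update_apply]
      simp only [State.setReg_arr, hx, hsucc, i6]
      by_cases hq : x = 2 * n * ((χ + 1) ^ (Δ + 2) + (χ - 1)) + k
      · rw [if_pos hq, if_pos (Or.inr hq)]
      · rw [if_neg hq]
        by_cases hp : ∃ v < k, x = v + 2 * n * ((χ + 1) ^ (Δ + 2) + (χ - 1))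
        · rw [if_pos hp, if_pos (Or.inl hp)]
        · rw [if_neg hp, if_neg fun h => h.elim hp hq]

theorem code_vertex (B χ Δ : ℕ) :
    code B ((Δ + 2) ::ₘ Multiset.replicate (χ - 1) 0) = B ^ (Δ + 2) + (χ - 1) := by
  simp [code]

/-- A bound for the running time of `mergeProg`. -/
def mergeTime (n χ Δ : ℕ) : ℕ :=
  ((Δ + 2) * (Δ + 2) * 4 + Δ * 4 + 30) + (((Δ + 2) * (Δ + 2) * (χ * 4 + 30) + 2) +
    ((χ * 4 + n * 9 + 20) + (((n - 1) * (roundTime n χ Δ + 3) + 2) + 2)))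

/-- Each round removes one representative, so after `n - 1` rounds a single module remains. It is
the whole graph, and register `13` tells whether it has a profile. -/
theorem ends_mergeProg {n : ℕ} {G : SimpleGraph (Fin n)} (hG : IsCograph G) {χ Δ : ℕ}
    (hχ : 1 ≤ χ) (hn : χ * (Δ + 1) < n) {s : State} (h0 : s.reg 0 = n) (h1 : s.reg 1 = χ)
    (h11 : s.reg 11 = Δ + 1) (ha : ∀ a, s.arr a = (input G χ Δ).arr a) :
    Ends mergeProg s (mergeTime n χ Δ) fun s' =>
      (Colorable G χ Δ → s'.reg 0 = 1) ∧ (¬ Colorable G χ Δ → s'.reg 0 = 0) := by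
  classical
  -- At least one round takes place, so the answer register has been written.
  have hn2 : 2 ≤ n := by nlinarith [Nat.mul_le_mul hχ (Nat.le_add_left 1 Δ)]
  have ha0 : ∀ a ≠ 0, ∀ x, s.arr a x = 0 := by
    intro a ha' x
    rw [ha a]
    simp [input, ha']
  refine Ends.seq (ends_paramProg h0 h1 h11) fun s₁ hf₁ ⟨p6, p7, p8, p9, p10, p21, p14, p15, p16⟩ =>
    ?_
  refine Ends.seq (ends_typeProg (by rw [hf₁.reg 0 rfl, h0]) (by rw [hf₁.reg 1 rfl, h1])
    (by rw [hf₁.reg 11 rfl, h11]) p6 p7 p8 p9 p14 p15 p16) fun s₂ hf₂ hready => ?_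
  refine Ends.seq (ends_vertexProg hready (by rw [hf₂.reg 10 rfl, p10])
    (by rw [hf₂.arr 6 rfl, hf₁.arr 6 rfl]; exact ha0 6 (by norm_num)))
    fun s₃ hf₃ ⟨v4, v11, v6⟩ => ?_
  have hready₃ : Ready n χ Δ s₃ := by
    refine hready.congr (fun r hr => ?_) (fun a ha => ?_)
    · simp only [List.mem_cons, List.not_mem_nil, or_false] at hr
      rcases hr with rfl | rfl | rfl | rfl | rfl | rfl <;> rw [hf₃.reg _ rfl]
    · simp only [List.mem_cons, List.not_mem_nil, or_false] at ha
      rcases ha with rfl | rfl | rfl <;> rw [hf₃.arr _ rfl]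
  have hgraph : HoldsGraph G s₃ := by
    intro u v
    rw [v11 u u.2, hf₃.arr 0 rfl, hf₂.arr 0 rfl, hf₁.arr 0 rfl, ha 0]
    have : (∃ i j : Fin n, (u : ℕ) * n + v = (i : ℕ) * n + j ∧ G.Adj i j) ↔ G.Adj u v := by
      constructor
      · rintro ⟨i, j, h, hij⟩
        have e : ∀ a b : Fin n, ((a : ℕ) * n + b) / n = a ∧ ((a : ℕ) * n + b) % n = b := by
          intro a b
          rw [mul_comm, Nat.mul_add_div (by omega), Nat.mul_add_mod, Nat.div_eq_of_lt b.2,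
            Nat.mod_eq_of_lt b.2]
          simp
        have hui : u = i := Fin.ext (by rw [← (e u v).1, h, (e i j).1])
        have hvj : v = j := Fin.ext (by rw [← (e u v).2, h, (e i j).2])
        rw [hui, hvj]
        exact hij
      · exact fun h => ⟨u, v, rfl, h⟩
    simp only [input, true_and, this]
    by_cases h : G.Adj u v <;> simp [h]
  have v5 : ∀ x, s₃.arr 5 x = 0 := by
    rw [hf₃.arr 5 rfl, hf₂.arr 5 rfl, hf₁.arr 5 rfl]
    exact ha0 5 (by norm_num)
  have hinit : RoundInv G χ Δ 0 id s₃ := by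
    refine ⟨fun u => v5 _, fun u _ => rfl, by simp [v5], fun u w _ => Iff.rfl, ?_, ?_, ?_, ?_⟩
    · intro u _
      rw [v4 u u.2]
      exact u.2
    · intro u _ k
      have : ({w | id w = u} : Finset (Fin n)) = {u} := by ext; simp
      rw [this, profiles_singleton G hχ, v4 u u.2, v6]
      simp only [Set.mem_singleton_iff, exists_eq_left, code_vertex]
      -- Both `u` and `v` are below `2 * n`, so division by `2 * n` recovers the code.
      have hiff : (∃ v < n, (u : ℕ) + 2 * n * k = v + 2 * n * ((χ + 1) ^ (Δ + 2) + (χ - 1))) ↔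
          (χ + 1) ^ (Δ + 2) + (χ - 1) = k := by
        constructor
        · rintro ⟨v, hv, h⟩
          have := congrArg (· / (2 * n)) h
          simpa [Nat.add_mul_div_left _ _ (show 0 < 2 * n by omega),
            Nat.div_eq_of_lt (show (u : ℕ) < 2 * n by omega),
            Nat.div_eq_of_lt (show v < 2 * n by omega)] using this.symm
        · rintro rfl
          exact ⟨u, u.2, rfl⟩
      simp only [hiff]
      split_ifs with h <;> simp [h]
    · intro x hx
      rw [v6, if_neg]
      rintro ⟨v, hv, rfl⟩
      rw [Nat.add_mul_mod_self_left, Nat.mod_eq_of_lt (by omega)] at hx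
      omega
    · intro h
      exact absurd h (lt_irrefl 0)
  refine Ends.seq_exec rfl ?_
  refine (Ends.forTo (N := n - 1) (T := roundTime n χ Δ) (fun r s' =>
    ∃ rep, RoundInv G χ Δ r rep s') (by rw [hf₃.reg 21 rfl, hf₂.reg 21 rfl, p21]) rfl rfl
    (by norm_num) ?_ ?_).mono le_rfl ?_
  · exact ⟨id, hinit.congr rfl rfl rfl (by simp)⟩
  · rintro r s₄ hr hi hf₄ ⟨rep, hinv⟩
    refine (ends_roundProg hG hinv (by omega) ?_ ?_ hi).mono le_rfl fun s₅ _ ⟨rep', h⟩ =>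
      ⟨rep', h.congr rfl rfl rfl (by simp)⟩
    · unfold HoldsGraph
      rw [hf₄.arr 0 rfl, hf₄.arr 11 rfl]
      exact hgraph
    · refine hready₃.congr (fun r hr => ?_) (fun a ha => ?_)
      · simp only [List.mem_cons, List.not_mem_nil, or_false] at hr
        rcases hr with rfl | rfl | rfl | rfl | rfl | rfl <;> rw [hf₄.reg _ rfl]
      · simp only [List.mem_cons, List.not_mem_nil, or_false] at ha
        rcases ha with rfl | rfl | rfl <;> rw [hf₄.arr _ rfl]
  · rintro s₄ - ⟨rep, hinv⟩
    obtain ⟨u, hu, hans⟩ := hinv.answer (by omega)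
    -- Only one vertex is alive, so it represents every vertex.
    have huniv : ({w | rep w = u} : Finset (Fin n)) = univ := by
      have hcard := hinv.card
      rw [show n - (n - 1) = 1 by omega, card_eq_one] at hcard
      obtain ⟨a, hcard⟩ := hcard
      have key : ∀ w : Fin n, s₄.arr 5 w = 0 → w = a := by
        intro w hw
        have : w ∈ ({u : Fin n | s₄.arr 5 u = 0} : Finset (Fin n)) := by simpa using hw
        rw [hcard] at this
        simpa using this
      rw [filter_eq_self]
      intro w _
      rw [key _ (hinv.alive w), key u hu]
    rw [huniv, ← colorable_iff_profiles_nonempty] at hans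
    have : ((copyReg 0 13).exec s₄).reg 0 = s₄.reg 13 := by simp [copyReg, Prog.exec]
    rw [this]
    tauto

/-- The number of colors is first capped at `n`, since multiplication by an arbitrary `χ` could take
unbounded time. The comparison with `n` is unaffected, and on the branch that merges `χ ≤ n` holds
anyway. -/
theorem ends_cographProg {n : ℕ} {G : SimpleGraph (Fin n)} (hG : IsCograph G) {χ Δ : ℕ}
    (hχ : 1 ≤ χ) :
    Ends cographProg (input G χ Δ)
      (n * 4 + 15 + if χ * (Δ + 1) < n then mergeTime n χ Δ else 0) fun s' =>
      (Colorable G χ Δ → s'.reg 0 = 1) ∧ (¬ Colorable G χ Δ → s'.reg 0 = 0) := by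
  refine (Ends.exec_seq_frame (T := (n * 4 + 3) +
    ((1 + if χ * (Δ + 1) < n then mergeTime n χ Δ else 0) + 1)) rfl fun hf₁ => ?_).mono
    (by
      have : (Prog.ifLt 0 1 (copyReg 1 0) skip ;; Prog.const 3 1 ;; Prog.add 11 2 3).size ≤ 8 := by
        decide
      omega) fun _ _ h => h
  set s₁ := (Prog.ifLt 0 1 (copyReg 1 0) skip ;; Prog.const 3 1 ;; Prog.add 11 2 3).exec
    (input G χ Δ) with hs₁
  have i0 : (input G χ Δ).reg 0 = n := by simp [input]
  have i1 : (input G χ Δ).reg 1 = χ := by simp [input]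
  have i2 : (input G χ Δ).reg 2 = Δ := by simp [input]
  have h1 : s₁.reg 1 = min χ n := by
    by_cases h : n < χ
    · rw [min_eq_right h.le]
      simp [hs₁, Prog.exec, copyReg, i0, i1, h]
    · rw [min_eq_left (not_lt.1 h)]
      simp [hs₁, Prog.exec, skip, i0, i1, h]
  have h11 : s₁.reg 11 = Δ + 1 := by
    by_cases h : n < χ <;> simp [hs₁, Prog.exec, copyReg, skip, i0, i1, i2, h]
  have h0 : s₁.reg 0 = n := by rw [hf₁.reg 0 rfl, i0]
  refine Ends.seq ((Ends.mul (z := 12) (x := 11) (y := 1) rfl rfl (by norm_num)).mono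
    (by rw [h1]; have := min_le_right χ n; omega) fun _ _ h => h) fun s₂ hf₂ h12 => ?_
  rw [h11, h1] at h12
  have g0 : s₂.reg 0 = n := by rw [hf₂.reg 0 rfl, h0]
  have hcond : (Δ + 1) * min χ n < n ↔ χ * (Δ + 1) < n := by
    rcases le_total χ n with h | h
    · rw [min_eq_left h, mul_comm]
    · rw [min_eq_right h]
      have e₁ : n ≤ (Δ + 1) * n := Nat.le_mul_of_pos_left n (by omega)
      have e₂ : n ≤ χ * (Δ + 1) := h.trans (Nat.le_mul_of_pos_right χ (by omega))
      omega
  refine Ends.ifLt (fun h => ?_) (fun h => ?_)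
  · rw [h12, g0, hcond] at h
    have hχn : χ ≤ n := (Nat.le_mul_of_pos_right χ (by omega : 0 < Δ + 1)).trans h.le
    refine (ends_mergeProg hG hχ h g0 ?_ ?_ ?_).mono (by rw [if_pos h]; omega) fun _ _ h => h
    · rw [hf₂.reg 1 rfl, h1, min_eq_left hχn]
    · rw [hf₂.reg 11 rfl, h11]
    · intro a
      rw [hf₂.arr a rfl, hf₁.arr a rfl]
  · rw [h12, g0, hcond] at h
    have hc : Colorable G χ Δ := colorable_of_le_mul G (not_lt.1 h)
    exact Ends.of_loopFree rfl (by simp [Prog.size]) ⟨fun _ => by simp [Prog.exec],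
      fun h' => absurd hc h'⟩

/-! ### The running time -/

theorem listBound_pos (χ P : ℕ) : 1 ≤ listBound χ P :=
  le_min (Nat.one_le_pow _ _ (by omega)) (Nat.one_le_pow _ _ (by omega))

theorem roundTime_le {n χ Δ : ℕ} (hn : 1 ≤ n) (hχ : χ ≤ n) (hΔ : Δ + 2 ≤ n) :
    roundTime n χ Δ ≤ 310 * (n ^ 5 * listBound χ ((Δ + 2) * (Δ + 2) * ((Δ + 2) * (Δ + 2)))) := by
  have hM := listBound_pos χ ((Δ + 2) * (Δ + 2) * ((Δ + 2) * (Δ + 2)))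
  unfold roundTime
  have hP : (Δ + 2) * (Δ + 2) * ((Δ + 2) * (Δ + 2)) ≤ n ^ 4 := by
    calc (Δ + 2) * (Δ + 2) * ((Δ + 2) * (Δ + 2)) = (Δ + 2) ^ 4 := by ring
      _ ≤ n ^ 4 := Nat.pow_le_pow_left hΔ 4
  generalize listBound χ ((Δ + 2) * (Δ + 2) * ((Δ + 2) * (Δ + 2))) = M at *
  generalize (Δ + 2) * (Δ + 2) * ((Δ + 2) * (Δ + 2)) = P at *
  have h5 : 1 ≤ n ^ 5 := Nat.one_le_pow _ _ hn
  have h1M : n ^ 5 ≤ n ^ 5 * M := Nat.le_mul_of_pos_right _ hM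
  have hM5 : M ≤ n ^ 5 * M := Nat.le_mul_of_pos_left _ h5
  have e₁ : n * (n * (n * 50 + 60) + 60) ≤ 170 * n ^ 5 := by
    have a₁ : n ≤ n ^ 5 := Nat.le_self_pow (by norm_num) n
    have a₂ : n ^ 2 ≤ n ^ 5 := Nat.pow_le_pow_right hn (by norm_num)
    have a₃ : n ^ 3 ≤ n ^ 5 := Nat.pow_le_pow_right hn (by norm_num)
    calc n * (n * (n * 50 + 60) + 60) = 50 * n ^ 3 + 60 * n ^ 2 + 60 * n := by ring
      _ ≤ 170 * n ^ 5 := by omega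
  have e₂ : P * (M * (χ * 13 + 11) + Δ * 4 + 63) ≤ 91 * (n ^ 5 * M) := by
    have b₁ : M * (χ * 13 + 11) ≤ M * (24 * n) := Nat.mul_le_mul_left _ (by omega)
    have b₂ : Δ * 4 + 63 ≤ 67 * n := by omega
    have b₃ : n ≤ M * n := Nat.le_mul_of_pos_left _ hM
    calc P * (M * (χ * 13 + 11) + Δ * 4 + 63) ≤ n ^ 4 * (M * (24 * n) + 67 * (M * n)) :=
          Nat.mul_le_mul hP (by omega)
      _ = 91 * (n ^ 5 * M) := by ring
  generalize n * (n * (n * 50 + 60) + 60) = A at *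
  generalize P * (M * (χ * 13 + 11) + Δ * 4 + 63) = B at *
  generalize n ^ 5 * M = D at *
  generalize n ^ 5 = E at *
  omega

theorem mergeTime_le {n χ Δ : ℕ} (hn : 2 ≤ n) (hχ : χ ≤ n) (hΔ : Δ + 2 ≤ n) :
    n * 4 + 15 + mergeTime n χ Δ ≤
      n ^ 15 * listBound χ ((Δ + 2) * (Δ + 2) * ((Δ + 2) * (Δ + 2))) := by
  have hR := roundTime_le (by omega) hχ hΔ
  have hM := listBound_pos χ ((Δ + 2) * (Δ + 2) * ((Δ + 2) * (Δ + 2)))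
  unfold mergeTime
  generalize listBound χ ((Δ + 2) * (Δ + 2) * ((Δ + 2) * (Δ + 2))) = M at *
  generalize roundTime n χ Δ = R at *
  have hm : (Δ + 2) * (Δ + 2) ≤ n ^ 2 := by
    rw [pow_two]
    exact Nat.mul_le_mul hΔ hΔ
  generalize (Δ + 2) * (Δ + 2) = m at *
  have hn1 : 1 ≤ n := by omega
  have h6 : 1 ≤ n ^ 6 := Nat.one_le_pow _ _ hn1
  have a₁ : n ≤ n ^ 6 := Nat.le_self_pow (by norm_num) n
  have a₂ : n ^ 2 ≤ n ^ 6 := Nat.pow_le_pow_right hn1 (by norm_num)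
  have a₃ : n ^ 3 ≤ n ^ 6 := Nat.pow_le_pow_right hn1 (by norm_num)
  have h1M : n ^ 6 ≤ n ^ 6 * M := Nat.le_mul_of_pos_right _ hM
  have b₁ : m * (χ * 4 + 30) ≤ 34 * n ^ 3 := by
    calc m * (χ * 4 + 30) ≤ n ^ 2 * (34 * n) := Nat.mul_le_mul hm (by omega)
      _ = 34 * n ^ 3 := by ring
  have b₂ : (n - 1) * (R + 3) ≤ 313 * (n ^ 6 * M) := by
    have : 3 ≤ 3 * (n ^ 5 * M) := by
      have := Nat.mul_le_mul (Nat.one_le_pow 5 n hn1) hM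
      omega
    calc (n - 1) * (R + 3) ≤ n * (313 * (n ^ 5 * M)) := Nat.mul_le_mul (by omega) (by omega)
      _ = 313 * (n ^ 6 * M) := by ring
  -- The numerical constants are absorbed into a power of `n`, using `n ≥ 2`; this turns `n ^ 6`
  -- into `n ^ 15`.
  have h9 : 512 ≤ n ^ 9 := by
    calc 512 = 2 ^ 9 := by norm_num
      _ ≤ n ^ 9 := Nat.pow_le_pow_left hn 9
  calc _ ≤ 512 * (n ^ 6 * M) := by omega
    _ ≤ n ^ 9 * (n ^ 6 * M) := Nat.mul_le_mul_right _ h9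
    _ = n ^ 15 * M := by ring

/-- The threshold `y = n ^ (1/5)` for `Δ + 1` balances the exponents: `P` is of order `(Δ + 1) ^ 4`,
while `χ < n / (Δ + 1)`, and both are of order `n ^ (4/5)` at the threshold. -/
theorem listBound_le {n χ Δ : ℕ} (hn : 2 ≤ n) (hχ : 1 ≤ χ) (h : χ * (Δ + 1) < n) :
    (listBound χ ((Δ + 2) * (Δ + 2) * ((Δ + 2) * (Δ + 2))) : ℝ) ≤
      (n : ℝ) ^ (16 * (n : ℝ) ^ (4 / 5 : ℝ)) := by
  have hn0 : (0 : ℝ) ≤ n := Nat.cast_nonneg n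
  have hn1 : (1 : ℝ) ≤ n := by exact_mod_cast (by omega : 1 ≤ n)
  have hχn : χ < n := (Nat.le_mul_of_pos_right χ (by omega)).trans_lt h
  have hΔn : Δ + 1 < n := (Nat.le_mul_of_pos_left (Δ + 1) hχ).trans_lt h
  set P := (Δ + 2) * (Δ + 2) * ((Δ + 2) * (Δ + 2)) with hP
  set y := (n : ℝ) ^ (1 / 5 : ℝ) with hy
  have hy0 : 0 ≤ y := Real.rpow_nonneg hn0 _
  have hy4 : y ^ 4 = (n : ℝ) ^ (4 / 5 : ℝ) := by
    rw [hy, ← Real.rpow_natCast, ← Real.rpow_mul hn0]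
    norm_num
  have hy5 : y ^ 5 = n := by
    rw [hy, ← Real.rpow_natCast, ← Real.rpow_mul hn0]
    norm_num
  rw [← hy4]
  rcases le_or_gt ((Δ : ℝ) + 1) y with hle | hlt
  · have hPle : (P : ℝ) ≤ 16 * y ^ 4 := by
      -- Here `1 ≤ Δ + 1 ≤ y`; the factor `2` becomes `2 ^ 4 = 16` in the exponent.
      have h2 : (Δ : ℝ) + 2 ≤ 2 * y := by
        have : (0 : ℝ) ≤ Δ := Nat.cast_nonneg Δ
        linarith
      calc (P : ℝ) = ((Δ : ℝ) + 2) ^ 4 := by rw [hP]; push_cast; ring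
        _ ≤ (2 * y) ^ 4 := pow_le_pow_left₀ (by positivity) h2 4
        _ = 16 * y ^ 4 := by ring
    calc (listBound χ P : ℝ) ≤ ((χ + 1) ^ P : ℕ) := by exact_mod_cast min_le_left _ _
      _ ≤ ((n ^ P : ℕ) : ℝ) := by exact_mod_cast Nat.pow_le_pow_left hχn P
      _ = (n : ℝ) ^ (P : ℝ) := by rw [Real.rpow_natCast]; push_cast; rfl
      _ ≤ _ := Real.rpow_le_rpow_of_exponent_le hn1 hPle
  -- From `χ * y ≤ χ * (Δ + 1) ≤ n = y ^ 5`, divide by `y`.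
  · have hχle : (χ : ℝ) ≤ y ^ 4 := by
      have hypos : 0 < y := Real.rpow_pos_of_pos (by linarith) _
      refine le_of_mul_le_mul_right ?_ hypos
      calc (χ : ℝ) * y ≤ χ * ((Δ : ℝ) + 1) := by gcongr
        _ ≤ n := by exact_mod_cast h.le
        _ = y ^ 4 * y := by rw [← hy5]; ring
    have hPn : P + 1 ≤ n ^ 5 := by
      have h₁ : P ≤ n ^ 4 := by
        calc P = (Δ + 2) ^ 4 := by rw [hP]; ring
          _ ≤ n ^ 4 := Nat.pow_le_pow_left hΔn 4
      have h₂ : 1 ≤ n ^ 4 := Nat.one_le_pow _ _ (by omega)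
      calc P + 1 ≤ n ^ 4 * 2 := by omega
        _ ≤ n ^ 4 * n := Nat.mul_le_mul_left _ hn
        _ = n ^ 5 := by ring
    calc (listBound χ P : ℝ) ≤ ((P + 1) ^ χ : ℕ) := by exact_mod_cast min_le_right _ _
      _ ≤ (((n ^ 5) ^ χ : ℕ) : ℝ) := by exact_mod_cast Nat.pow_le_pow_left hPn χ
      _ = (n : ℝ) ^ (5 * (χ : ℝ)) := by
        rw [← pow_mul, Nat.cast_pow, ← Real.rpow_natCast]
        push_cast
        rfl
      _ ≤ _ := Real.rpow_le_rpow_of_exponent_le hn1 (by linarith [pow_nonneg hy0 4])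

/-- A bound for the running time on graphs with `n` vertices. -/
noncomputable def timeBound (n : ℕ) : ℕ :=
  if 2 ≤ n then ⌊(n : ℝ) ^ (31 * (n : ℝ) ^ (4 / 5 : ℝ))⌋₊ else 19

theorem pow_fifteen_le {n : ℕ} (hn : 2 ≤ n) :
    (n : ℝ) ^ 15 ≤ (n : ℝ) ^ (15 * (n : ℝ) ^ (4 / 5 : ℝ)) := by
  have hn1 : (1 : ℝ) ≤ n := by exact_mod_cast (by omega : 1 ≤ n)
  rw [← Real.rpow_natCast]
  refine Real.rpow_le_rpow_of_exponent_le hn1 ?_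
  have := Real.one_le_rpow hn1 (show (0 : ℝ) ≤ 4 / 5 by norm_num)
  push_cast
  linarith

/-- The exponent `31` is `15` for the polynomial factor plus `16` for the list bound. For `n ≤ 1`
the merging branch is impossible because `χ * (Δ + 1) ≥ 1`, and `n * 4 + 15 ≤ 19`. -/
theorem time_le_timeBound {n χ Δ : ℕ} (hχ : 1 ≤ χ) :
    (n * 4 + 15 + if χ * (Δ + 1) < n then mergeTime n χ Δ else 0) ≤ timeBound n := by
  unfold timeBound
  by_cases hn : 2 ≤ n
  · rw [if_pos hn]
    apply Nat.le_floor
    have hn0 : (0 : ℝ) < n := by exact_mod_cast (by omega : 0 < n)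
    have hsplit : (n : ℝ) ^ (31 * (n : ℝ) ^ (4 / 5 : ℝ)) =
        (n : ℝ) ^ (15 * (n : ℝ) ^ (4 / 5 : ℝ)) * (n : ℝ) ^ (16 * (n : ℝ) ^ (4 / 5 : ℝ)) := by
      rw [← Real.rpow_add hn0]
      congr 1
      ring
    rw [hsplit]
    by_cases h : χ * (Δ + 1) < n
    · rw [if_pos h]
      have hχn : χ ≤ n := (Nat.le_mul_of_pos_right χ (by omega)).trans h.le
      have hΔn : Δ + 1 < n := (Nat.le_mul_of_pos_left (Δ + 1) hχ).trans_lt h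
      calc ((n * 4 + 15 + mergeTime n χ Δ : ℕ) : ℝ)
          ≤ ((n ^ 15 * listBound χ ((Δ + 2) * (Δ + 2) * ((Δ + 2) * (Δ + 2))) : ℕ) : ℝ) := by
            exact_mod_cast mergeTime_le hn hχn hΔn
        _ ≤ _ := by
            push_cast
            have h₁ := listBound_le hn hχ h
            exact mul_le_mul (pow_fifteen_le hn) h₁ (Nat.cast_nonneg _) (by positivity)
    · rw [if_neg h, add_zero]
      have h₁ : n * 4 + 15 ≤ n ^ 15 := by
        calc n * 4 + 15 ≤ 2 ^ 14 * n := by omega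
          _ ≤ n ^ 14 * n := Nat.mul_le_mul_right _ (Nat.pow_le_pow_left hn 14)
          _ = n ^ 15 := by ring
      have h₂ : (1 : ℝ) ≤ (n : ℝ) ^ (16 * (n : ℝ) ^ (4 / 5 : ℝ)) :=
        Real.one_le_rpow (by exact_mod_cast (by omega : 1 ≤ n)) (by positivity)
      calc ((n * 4 + 15 : ℕ) : ℝ) ≤ (n : ℝ) ^ 15 * 1 := by rw [mul_one]; exact_mod_cast h₁
        _ ≤ _ := mul_le_mul (pow_fifteen_le hn) h₂ zero_le_one (by positivity)
  · rw [if_neg hn, if_neg]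
    · omega
    · have := Nat.mul_le_mul hχ (Nat.le_add_left 1 Δ)
      omega

end DefectiveColoring

theorem mainTheorem7 :
    ∃ (p : DefectiveColoring.Prog) (T : ℕ → ℕ) (C : ℝ),
      DefectiveColoring.SolvesOnCographs p T ∧
        ∀ n : ℕ, 2 ≤ n → (T n : ℝ) ≤ (n : ℝ) ^ (C * (n : ℝ) ^ (4 / 5 : ℝ)) := by
  refine ⟨DefectiveColoring.cographProg, DefectiveColoring.timeBound, 31, ?_, ?_⟩
  · intro n G hG χ Δ hχ
    exact (DefectiveColoring.ends_cographProg hG hχ).mono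
      (DefectiveColoring.time_le_timeBound hχ) fun _ _ h => h
  · intro n hn
    rw [DefectiveColoring.timeBound, if_pos hn]
    exact Nat.floor_le (by positivity)
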